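/- Let $k$ be an algebraically closed field of characteristic zero and let $G$ be a finite group with trivial center, $Z(G)=1$. Let $F\trianglelefteq G$ be a normal subgroup of prime index. Let $S\subseteq G$ be a subgroup and let $\alpha\in Z^2(S,k^*)$ be a non-degenerate $2$-cocycle, i.e. $s=1$ is the only element $s\in S$ with $\alpha(s,t)=\alpha(t,s)$ for all $t\in C_S(s)$. Let $k_\alpha S$ be the twisted group algebra, with basis $(x_s)_{s\in S}$ and $x_sx_t=\alpha(s,t)x_{st}$, and let $$A=A(G,S,\alpha)=\{f:G\to k_\alpha S \;:\; f(sg)=x_s f(g)x_s^{-1}\ \text{ for all } s\in S,\ g\in G\},$$ an algebra under pointwise operations with $G$-action $(g.f)(h)=f(hg)$, equivalently with coaction $\rho(a)=a_{(0)}\otimes a_{(1)}=\sum_{g\in G}g.a\otimes e_g$ of the Hopf algebra $k^G$ of functions on $G$, where $e_g(h)=\delta_{g,h}$. Then $A$ is a $k^G$-Galois object: $A\neq 0$, $A^{\mathrm{co}\,k^G}=k$, and $\mathrm{can}:A\otimes A\to A\otimes k^G$, $x\otimes y\mapsto xy_{(0)}\otimes y_{(1)}$, is bijective. The Miyashita–Ulbrich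 action of $k^G$ on $A$ is $x\leftharpoonup h=h^{[1]}xh^{[2]}$, where $\mathrm{can}(h^{[1]}\otimes h^{[2]})=1\otimes h$. Let $A^F=\{a\in A : g.a=a\ \text{ for all } g\in F\}$. (1) $A^F$ is a $k^G$-submodule of $A$ with respect to the Miyashita–Ulbrich action if and only if $S\subseteq F$. (2) Let $J\in kS\otimes kS\subseteq kG\otimes kG$ be a twist of $kG$ corresponding to $A$. That is, $J$ is invertible, $(J\otimes 1)(\Delta\otimes\mathrm{id})(J)=(1\otimes J)(\mathrm{id}\otimes\Delta)(J)$, $(\varepsilon\otimes\mathrm{id})(J)=1=(\mathrm{id}\otimes\varepsilon)(J)$, and $A$ is isomorphic, as an algebra with $G$-action, to the space $k^G=(kG)^*$ with product $(ff')(x)=(f\otimes f')(J\Delta(x))$, unit $\varepsilon$ and action $(g.f)(x)=f(xg)$. Let $(kG)^J$ be the Hopf algebra with underlying algebra $kG$ and comultiplication $\Delta_J(x)=J\Delta(x)J^{-1}$, and let $\overline J$ be the image of $J$ in $k(G/F)\otimes k(G/F)$. Then the quotient $(kG)^J\to k(G/F)^{\overline J}$ is conormal (i.e. the dual inclusion identifies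 $(k(G/F)^{\overline J})^*$ with a normal Hopf subalgebra of $((kG)^J)^*$, one stable under the left and right adjoint actions) if and only if $J\in kF\otimes kF$. Moreover the two equivalences express the same condition: for every $J$ as in (2), the quotient $(kG)^J\to k(G/F)^{\overline J}$ is conormal if and only if $A^F$ is a $k^G$-submodule of $A$ with respect to the Miyashita–Ulbrich action. -/

import Mathlib

open scoped TensorProduct

noncomputable section

/-! ### Twists of Hopf algebras and twisted Hopf algebras -/

section Twisting

variable {k : Type*} [Field k]

/-- A (normalized) twist of a Hopf algebra `H`: an invertible `J ∈ H ⊗ H` with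
`(J ⊗ 1) (Δ ⊗ id)(J) = (1 ⊗ J) (id ⊗ Δ)(J)` and `(ε ⊗ id)(J) = 1 = (id ⊗ ε)(J)`.
For `H` finite dimensional this is the same thing as a convolution invertible normalized
`2`-cocycle on the dual Hopf algebra. -/
structure HopfTwist (k H : Type*) [Field k] [Ring H] [HopfAlgebra k H] where
  /-- the underlying invertible element -/
  val : (H ⊗[k] H)ˣ
  cocycle :
    Algebra.TensorProduct.assoc k k k H H H
        ((val : H ⊗[k] H) ⊗ₜ[k] (1 : H)) *
      Algebra.TensorProduct.assoc k k k H H H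
        (Algebra.TensorProduct.map (Bialgebra.comulAlgHom k H) (AlgHom.id k H) (val : H ⊗[k] H)) =
    ((1 : H) ⊗ₜ[k] (val : H ⊗[k] H)) *
      Algebra.TensorProduct.map (AlgHom.id k H) (Bialgebra.comulAlgHom k H) (val : H ⊗[k] H)
  counit_left : Algebra.TensorProduct.lid k H
    (Algebra.TensorProduct.map (Bialgebra.counitAlgHom k H) (AlgHom.id k H) (val : H ⊗[k] H)) = 1
  counit_right : Algebra.TensorProduct.rid k k H
    (Algebra.TensorProduct.map (AlgHom.id k H) (Bialgebra.counitAlgHom k H) (val : H ⊗[k] H)) = 1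

namespace HopfTwist

variable {H H' : Type*} [Ring H] [HopfAlgebra k H] [Ring H'] [HopfAlgebra k H']

/-- The image `(φ ⊗ φ)(J)` of a twist under a homomorphism of Hopf algebras. -/
def map (φ : H →ₐc[k] H') (J : HopfTwist k H) : HopfTwist k H' where
  val := Units.map
    (Algebra.TensorProduct.map (φ : H →ₐ[k] H') (φ : H →ₐ[k] H') :
      H ⊗[k] H →* H' ⊗[k] H') J.val
  cocycle := by
    let Φ : H ⊗[k] (H ⊗[k] H) →ₐ[k] H' ⊗[k] (H' ⊗[k] H') :=
      Algebra.TensorProduct.map (φ : H →ₐ[k] H')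
        (Algebra.TensorProduct.map (φ : H →ₐ[k] H') (φ : H →ₐ[k] H'))
    let φ₂ : H ⊗[k] H →ₐ[k] H' ⊗[k] H' :=
      Algebra.TensorProduct.map (φ : H →ₐ[k] H') (φ : H →ₐ[k] H')
    have hφ : ∀ x : H, Bialgebra.comulAlgHom k H' (φ x) = φ₂ (Bialgebra.comulAlgHom k H x) :=
      fun x => (DFunLike.congr_fun (BialgHomClass.map_comp_comulAlgHom φ) x).symm
    have h1 : ∀ y : H ⊗[k] H, Φ (Algebra.TensorProduct.assoc k k k H H H (y ⊗ₜ[k] (1 : H))) =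
        Algebra.TensorProduct.assoc k k k H' H' H' (φ₂ y ⊗ₜ[k] (1 : H')) := by
      intro y
      induction y with
      | zero => simp
      | tmul a b => simp [Φ, φ₂]
      | add a b ha hb => simp only [TensorProduct.add_tmul, map_add, ha, hb]
    have h2 : ∀ y : H ⊗[k] H, Φ ((1 : H) ⊗ₜ[k] y) = (1 : H') ⊗ₜ[k] φ₂ y := by
      intro y
      simp [Φ, φ₂]
    have h3 : ∀ y : H ⊗[k] H, Φ (Algebra.TensorProduct.map (AlgHom.id k H)
        (Bialgebra.comulAlgHom k H) y) =
        Algebra.TensorProduct.map (AlgHom.id k H') (Bialgebra.comulAlgHom k H') (φ₂ y) := by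
      intro y
      induction y with
      | zero => simp
      | tmul a b =>
        have := hφ b
        simp only [Φ, φ₂, Algebra.TensorProduct.map_tmul, AlgHom.coe_id, id_eq] at this ⊢
        rw [← this]
        rfl
      | add a b ha hb => simp only [map_add, ha, hb]
    have h4 : ∀ y : H ⊗[k] H, Φ (Algebra.TensorProduct.assoc k k k H H H
        (Algebra.TensorProduct.map (Bialgebra.comulAlgHom k H) (AlgHom.id k H) y)) =
        Algebra.TensorProduct.assoc k k k H' H' H'
          (Algebra.TensorProduct.map (Bialgebra.comulAlgHom k H') (AlgHom.id k H') (φ₂ y)) := by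
      have h5 : ∀ (z : H ⊗[k] H) (c : H),
          Φ (Algebra.TensorProduct.assoc k k k H H H (z ⊗ₜ[k] c)) =
          Algebra.TensorProduct.assoc k k k H' H' H' (φ₂ z ⊗ₜ[k] φ c) := by
        intro z c
        induction z with
        | zero => simp
        | tmul a b => simp [Φ, φ₂]
        | add a b ha hb => simp only [TensorProduct.add_tmul, map_add, ha, hb]
      intro y
      induction y with
      | zero => simp
      | tmul a b =>
        rw [Algebra.TensorProduct.map_tmul, h5, ← hφ a]
        simp [φ₂]
      | add a b ha hb => simp only [map_add, ha, hb]
    have key := congrArg Φ J.cocycle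
    rw [map_mul, map_mul, h1, h2, h3, h4] at key
    exact key
  counit_left := by
    have h : ∀ y : H ⊗[k] H, Algebra.TensorProduct.lid k H'
        (Algebra.TensorProduct.map (Bialgebra.counitAlgHom k H') (AlgHom.id k H')
          (Algebra.TensorProduct.map (φ : H →ₐ[k] H') (φ : H →ₐ[k] H') y)) =
        φ (Algebra.TensorProduct.lid k H
        (Algebra.TensorProduct.map (Bialgebra.counitAlgHom k H) (AlgHom.id k H) y)) := by
      intro y
      induction y with
      | zero => simp
      | tmul a b => simp
      | add a b ha hb => simp only [map_add, ha, hb]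
    have := h J.val
    rw [J.counit_left, map_one] at this
    exact this
  counit_right := by
    have h : ∀ y : H ⊗[k] H, Algebra.TensorProduct.rid k k H'
        (Algebra.TensorProduct.map (AlgHom.id k H') (Bialgebra.counitAlgHom k H')
          (Algebra.TensorProduct.map (φ : H →ₐ[k] H') (φ : H →ₐ[k] H') y)) =
        φ (Algebra.TensorProduct.rid k k H
        (Algebra.TensorProduct.map (AlgHom.id k H) (Bialgebra.counitAlgHom k H) y)) := by
      intro y
      induction y with
      | zero => simp
      | tmul a b => simp
      | add a b ha hb => simp only [map_add, ha, hb]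
    have := h J.val
    rw [J.counit_right, map_one] at this
    exact this

/-- The underlying algebra of the twisted Hopf algebra `H^J`, which is that of `H`. -/
def Twisted (_J : HopfTwist k H) : Type _ := H

variable (J : HopfTwist k H)

instance : Ring J.Twisted := inferInstanceAs (Ring H)

instance : Algebra k J.Twisted := inferInstanceAs (Algebra k H)

/-- The twisted comultiplication `Δ_J(x) = J Δ(x) J⁻¹`. -/
def twistedComul : H →ₐ[k] H ⊗[k] H :=
  AlgHom.ofLinearMap
    (LinearMap.mulLeft k (J.val : H ⊗[k] H) ∘ₗ
      LinearMap.mulRight k ((J.val⁻¹ : (H ⊗[k] H)ˣ) : H ⊗[k] H) ∘ₗ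
      (Bialgebra.comulAlgHom k H).toLinearMap)
    (by simp)
    (by intro x y; simp [mul_assoc])

lemma twistedComul_apply (x : H) : J.twistedComul x =
    (J.val : H ⊗[k] H) * (Bialgebra.comulAlgHom k H x *
      ((J.val⁻¹ : (H ⊗[k] H)ˣ) : H ⊗[k] H)) := rfl

lemma cocycle_inv :
    Algebra.TensorProduct.assoc k k k H H H
        (Algebra.TensorProduct.map (Bialgebra.comulAlgHom k H) (AlgHom.id k H)
          ((J.val⁻¹ : (H ⊗[k] H)ˣ) : H ⊗[k] H)) *
      Algebra.TensorProduct.assoc k k k H H H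
        (((J.val⁻¹ : (H ⊗[k] H)ˣ) : H ⊗[k] H) ⊗ₜ[k] (1 : H)) =
    Algebra.TensorProduct.map (AlgHom.id k H) (Bialgebra.comulAlgHom k H)
        ((J.val⁻¹ : (H ⊗[k] H)ˣ) : H ⊗[k] H) *
      ((1 : H) ⊗ₜ[k] ((J.val⁻¹ : (H ⊗[k] H)ˣ) : H ⊗[k] H)) := by
  let f1 : H ⊗[k] H →ₐ[k] H ⊗[k] (H ⊗[k] H) :=
    (Algebra.TensorProduct.assoc k k k H H H).toAlgHom.comp
      Algebra.TensorProduct.includeLeft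
  let f2 : H ⊗[k] H →ₐ[k] H ⊗[k] (H ⊗[k] H) :=
    (Algebra.TensorProduct.assoc k k k H H H).toAlgHom.comp
      (Algebra.TensorProduct.map (Bialgebra.comulAlgHom k H) (AlgHom.id k H))
  let g1 : H ⊗[k] H →ₐ[k] H ⊗[k] (H ⊗[k] H) := Algebra.TensorProduct.includeRight
  let g2 : H ⊗[k] H →ₐ[k] H ⊗[k] (H ⊗[k] H) :=
    Algebra.TensorProduct.map (AlgHom.id k H) (Bialgebra.comulAlgHom k H)
  have h : Units.map (f1 : H ⊗[k] H →* H ⊗[k] (H ⊗[k] H)) J.val *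
        Units.map (f2 : H ⊗[k] H →* H ⊗[k] (H ⊗[k] H)) J.val =
      Units.map (g1 : H ⊗[k] H →* H ⊗[k] (H ⊗[k] H)) J.val * Units.map (g2 : H ⊗[k] H →* H ⊗[k] (H ⊗[k] H)) J.val :=
    Units.ext J.cocycle
  have h' := congrArg (fun u => ((u⁻¹ : (H ⊗[k] (H ⊗[k] H))ˣ) : H ⊗[k] (H ⊗[k] H))) h
  simp only [mul_inv_rev, Units.val_mul] at h'
  exact h'

lemma twistedComul_coassoc (x : H) :
    Algebra.TensorProduct.assoc k k k H H H
      (Algebra.TensorProduct.map J.twistedComul (AlgHom.id k H) (J.twistedComul x)) =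
    Algebra.TensorProduct.map (AlgHom.id k H) J.twistedComul (J.twistedComul x) := by
  have h1 : ∀ y : H ⊗[k] H, Algebra.TensorProduct.map J.twistedComul (AlgHom.id k H) y =
      ((J.val : H ⊗[k] H) ⊗ₜ[k] (1 : H)) *
        (Algebra.TensorProduct.map (Bialgebra.comulAlgHom k H) (AlgHom.id k H) y *
        (((J.val⁻¹ : (H ⊗[k] H)ˣ) : H ⊗[k] H) ⊗ₜ[k] (1 : H))) := by
    intro y
    induction y with
    | zero => simp
    | tmul a b =>
      simp only [Algebra.TensorProduct.map_tmul, Algebra.TensorProduct.tmul_mul_tmul,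
        twistedComul_apply, AlgHom.coe_id, id_eq, one_mul, mul_one]
    | add a b ha hb => simp only [map_add, ha, hb, mul_add, add_mul]
  have h2 : ∀ y : H ⊗[k] H, Algebra.TensorProduct.map (AlgHom.id k H) J.twistedComul y =
      ((1 : H) ⊗ₜ[k] (J.val : H ⊗[k] H)) *
        (Algebra.TensorProduct.map (AlgHom.id k H) (Bialgebra.comulAlgHom k H) y *
        ((1 : H) ⊗ₜ[k] ((J.val⁻¹ : (H ⊗[k] H)ˣ) : H ⊗[k] H))) := by
    intro y
    induction y with
    | zero => simp
    | tmul a b =>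
      simp only [Algebra.TensorProduct.map_tmul, Algebra.TensorProduct.tmul_mul_tmul,
        twistedComul_apply, AlgHom.coe_id, id_eq, one_mul, mul_one]
    | add a b ha hb => simp only [map_add, ha, hb, mul_add, add_mul]
  have h3 : Algebra.TensorProduct.assoc k k k H H H
      (Algebra.TensorProduct.map (Bialgebra.comulAlgHom k H) (AlgHom.id k H)
        (Bialgebra.comulAlgHom k H x)) =
      Algebra.TensorProduct.map (AlgHom.id k H) (Bialgebra.comulAlgHom k H)
        (Bialgebra.comulAlgHom k H x) := Coalgebra.coassoc_apply x
  rw [h1, h2, twistedComul_apply]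
  simp only [map_mul]
  rw [h3]
  have c1 := J.cocycle
  have c2 := J.cocycle_inv
  simp only [← mul_assoc] at c1 ⊢
  rw [c1]
  simp only [mul_assoc]
  rw [c2]

lemma counit_left_inv : Algebra.TensorProduct.lid k H
    (Algebra.TensorProduct.map (Bialgebra.counitAlgHom k H) (AlgHom.id k H)
      ((J.val⁻¹ : (H ⊗[k] H)ˣ) : H ⊗[k] H)) = 1 := by
  have h : Algebra.TensorProduct.lid k H
      (Algebra.TensorProduct.map (Bialgebra.counitAlgHom k H) (AlgHom.id k H)
        ((J.val : H ⊗[k] H) * ((J.val⁻¹ : (H ⊗[k] H)ˣ) : H ⊗[k] H))) = 1 := by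
    rw [Units.mul_inv, map_one, map_one]
  rwa [map_mul, map_mul, J.counit_left, one_mul] at h

lemma counit_right_inv : Algebra.TensorProduct.rid k k H
    (Algebra.TensorProduct.map (AlgHom.id k H) (Bialgebra.counitAlgHom k H)
      ((J.val⁻¹ : (H ⊗[k] H)ˣ) : H ⊗[k] H)) = 1 := by
  have h : Algebra.TensorProduct.rid k k H
      (Algebra.TensorProduct.map (AlgHom.id k H) (Bialgebra.counitAlgHom k H)
        ((J.val : H ⊗[k] H) * ((J.val⁻¹ : (H ⊗[k] H)ˣ) : H ⊗[k] H))) = 1 := by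
    rw [Units.mul_inv, map_one, map_one]
  rwa [map_mul, map_mul, J.counit_right, one_mul] at h

/-- The element `U = J¹ S(J²)`. -/
def antipodeUnit : H :=
  LinearMap.mul' k H ((HopfAlgebra.antipode k (A := H)).lTensor H (J.val : H ⊗[k] H))

/-- The element `S(j¹) j²`, where `J⁻¹ = j¹ ⊗ j²`; it is the inverse of `U`. -/
def antipodeUnitInv : H :=
  LinearMap.mul' k H ((HopfAlgebra.antipode k (A := H)).rTensor H
    ((J.val⁻¹ : (H ⊗[k] H)ˣ) : H ⊗[k] H))

/-- The twisted antipode `S_J(x) = U S(x) U⁻¹`. -/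
def twistedAntipode : H →ₗ[k] H :=
  LinearMap.mulLeft k J.antipodeUnit ∘ₗ LinearMap.mulRight k J.antipodeUnitInv ∘ₗ
    HopfAlgebra.antipode k

/-- The element `U` is invertible with the stated inverse. -/
lemma antipodeUnit_mul_inv : J.antipodeUnit * J.antipodeUnitInv = 1 := by
  let S : H →ₗ[k] H := HopfAlgebra.antipode k
  -- the linear map `a ⊗ b ⊗ c ↦ a S(b) c`
  let Θ : H ⊗[k] (H ⊗[k] H) →ₗ[k] H :=
    LinearMap.mul' k H ∘ₗ (LinearMap.mul' k H ∘ₗ S.rTensor H).lTensor H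
  have hΘ : ∀ a b c : H, Θ (a ⊗ₜ[k] (b ⊗ₜ[k] c)) = a * (S b * c) := fun a b c => rfl
  have hS : ∀ a b : H, S (a * b) = S b * S a := HopfAlgebra.antipode_mul_antidistrib
  have e1 : ∀ X Y : H ⊗[k] H,
      Θ (((1 : H) ⊗ₜ[k] Y) * Algebra.TensorProduct.assoc k k k H H H (X ⊗ₜ[k] (1 : H))) =
      LinearMap.mul' k H (S.lTensor H X) * LinearMap.mul' k H (S.rTensor H Y) := by
    intro X Y
    induction X with
    | zero => simp
    | add a b ha hb => simp only [TensorProduct.add_tmul, map_add, mul_add, ha, hb, add_mul]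
    | tmul a b =>
      induction Y with
      | zero => simp
      | add c d hc hd => simp only [TensorProduct.tmul_add, map_add, mul_add, hc, hd, add_mul]
      | tmul c d =>
        simp only [Algebra.TensorProduct.assoc_tmul, Algebra.TensorProduct.tmul_mul_tmul, hΘ,
          one_mul, mul_one, hS, LinearMap.lTensor_tmul, LinearMap.rTensor_tmul,
          LinearMap.mul'_apply, mul_assoc]
  have e2 : ∀ X Y : H ⊗[k] H,
      Θ (Algebra.TensorProduct.map (AlgHom.id k H) (Bialgebra.comulAlgHom k H) X *
        Algebra.TensorProduct.assoc k k k H H H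
          (Algebra.TensorProduct.map (Bialgebra.comulAlgHom k H) (AlgHom.id k H) Y)) =
      Algebra.TensorProduct.rid k k H
        (Algebra.TensorProduct.map (AlgHom.id k H) (Bialgebra.counitAlgHom k H) X) *
      Algebra.TensorProduct.lid k H
        (Algebra.TensorProduct.map (Bialgebra.counitAlgHom k H) (AlgHom.id k H) Y) := by
    intro X Y
    induction X with
    | zero => simp
    | add a b ha hb => simp only [map_add, add_mul, ha, hb]
    | tmul a b =>
      induction Y with
      | zero => simp
      | add c d hc hd => simp only [map_add, mul_add, hc, hd]
      | tmul c d =>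
        have hm : ∀ (P Q : H ⊗[k] H),
            Θ ((a ⊗ₜ[k] P) * Algebra.TensorProduct.assoc k k k H H H (Q ⊗ₜ[k] d)) =
            a * (LinearMap.mul' k H (S.lTensor H Q) * (LinearMap.mul' k H (S.rTensor H P) * d)) := by
          intro P Q
          induction P with
          | zero => simp
          | add p q hp hq => simp only [TensorProduct.tmul_add, map_add, add_mul, mul_add, hp, hq]
          | tmul p q =>
            induction Q with
            | zero => simp
            | add r s hr hs => simp only [TensorProduct.add_tmul, map_add, add_mul, mul_add, hr, hs]
            | tmul r s =>
              simp only [Algebra.TensorProduct.assoc_tmul, Algebra.TensorProduct.tmul_mul_tmul, hΘ,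
                hS, LinearMap.lTensor_tmul, LinearMap.rTensor_tmul,
                LinearMap.mul'_apply, mul_assoc]
        have hm' := hm (Coalgebra.comul b) (Coalgebra.comul c)
        rw [HopfAlgebra.mul_antipode_lTensor_comul_apply,
          HopfAlgebra.mul_antipode_rTensor_comul_apply] at hm'
        simp only [Algebra.TensorProduct.map_tmul, AlgHom.coe_id, id_eq,
          Bialgebra.comulAlgHom_apply, hm', Algebra.TensorProduct.rid_tmul,
          Algebra.TensorProduct.lid_tmul, Bialgebra.counitAlgHom_apply,
          Algebra.algebraMap_eq_smul_one, smul_mul_assoc, mul_smul_comm, one_mul]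
        rw [smul_comm]
  have key : ((1 : H) ⊗ₜ[k] ((J.val⁻¹ : (H ⊗[k] H)ˣ) : H ⊗[k] H)) *
      Algebra.TensorProduct.assoc k k k H H H ((J.val : H ⊗[k] H) ⊗ₜ[k] (1 : H)) =
      Algebra.TensorProduct.map (AlgHom.id k H) (Bialgebra.comulAlgHom k H) (J.val : H ⊗[k] H) *
        Algebra.TensorProduct.assoc k k k H H H
          (Algebra.TensorProduct.map (Bialgebra.comulAlgHom k H) (AlgHom.id k H)
            ((J.val⁻¹ : (H ⊗[k] H)ˣ) : H ⊗[k] H)) := by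
    have c1 := J.cocycle
    have i1 : ((1 : H) ⊗ₜ[k] ((J.val⁻¹ : (H ⊗[k] H)ˣ) : H ⊗[k] H)) *
        ((1 : H) ⊗ₜ[k] (J.val : H ⊗[k] H)) = 1 := by
      rw [Algebra.TensorProduct.tmul_mul_tmul, Units.inv_mul, one_mul]
      rfl
    have i2 : Algebra.TensorProduct.assoc k k k H H H
        (Algebra.TensorProduct.map (Bialgebra.comulAlgHom k H) (AlgHom.id k H)
          (J.val : H ⊗[k] H)) *
        Algebra.TensorProduct.assoc k k k H H H
        (Algebra.TensorProduct.map (Bialgebra.comulAlgHom k H) (AlgHom.id k H)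
          ((J.val⁻¹ : (H ⊗[k] H)ˣ) : H ⊗[k] H)) = 1 := by
      rw [← map_mul, ← map_mul, Units.mul_inv, map_one, map_one]
    have c2 := congrArg (fun z => ((1 : H) ⊗ₜ[k] ((J.val⁻¹ : (H ⊗[k] H)ˣ) : H ⊗[k] H)) * z *
      Algebra.TensorProduct.assoc k k k H H H
        (Algebra.TensorProduct.map (Bialgebra.comulAlgHom k H) (AlgHom.id k H)
          ((J.val⁻¹ : (H ⊗[k] H)ˣ) : H ⊗[k] H))) c1
    rw [← mul_assoc ((1 : H) ⊗ₜ[k] ((J.val⁻¹ : (H ⊗[k] H)ˣ) : H ⊗[k] H)), mul_assoc, i2, mul_one,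
      ← mul_assoc ((1 : H) ⊗ₜ[k] ((J.val⁻¹ : (H ⊗[k] H)ˣ) : H ⊗[k] H)), i1, one_mul] at c2
    exact c2
  have := congrArg Θ key
  rw [e1, e2, J.counit_right, J.counit_left_inv, mul_one] at this
  exact this

lemma twistedComul_counit_left (x : H) :
    (Coalgebra.counit (R := k) (A := H)).rTensor H (J.twistedComul x) = (1 : k) ⊗ₜ[k] x := by
  refine (Algebra.TensorProduct.lid k H).injective ?_
  change Algebra.TensorProduct.lid k H
    (Algebra.TensorProduct.map (Bialgebra.counitAlgHom k H) (AlgHom.id k H)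
      (J.twistedComul x)) = Algebra.TensorProduct.lid k H ((1 : k) ⊗ₜ[k] x)
  have hx : Algebra.TensorProduct.map (Bialgebra.counitAlgHom k H) (AlgHom.id k H)
      (Bialgebra.comulAlgHom k H x) = (1 : k) ⊗ₜ[k] x := Coalgebra.rTensor_counit_comul x
  rw [twistedComul_apply, map_mul, map_mul, map_mul, map_mul, J.counit_left,
    J.counit_left_inv, hx, one_mul, mul_one]

lemma twistedComul_counit_right (x : H) :
    (Coalgebra.counit (R := k) (A := H)).lTensor H (J.twistedComul x) = x ⊗ₜ[k] (1 : k) := by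
  refine (Algebra.TensorProduct.rid k k H).injective ?_
  change Algebra.TensorProduct.rid k k H
    (Algebra.TensorProduct.map (AlgHom.id k H) (Bialgebra.counitAlgHom k H)
      (J.twistedComul x)) = Algebra.TensorProduct.rid k k H (x ⊗ₜ[k] (1 : k))
  have hx : Algebra.TensorProduct.map (AlgHom.id k H) (Bialgebra.counitAlgHom k H)
      (Bialgebra.comulAlgHom k H x) = x ⊗ₜ[k] (1 : k) := Coalgebra.lTensor_counit_comul x
  rw [twistedComul_apply, map_mul, map_mul, map_mul, map_mul, J.counit_right,
    J.counit_right_inv, hx, one_mul, mul_one]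

lemma twistedAntipode_left (x : H) :
    LinearMap.mul' k H (J.twistedAntipode.rTensor H (J.twistedComul x)) =
      algebraMap k H (Coalgebra.counit (R := k) x) := by
  let S : H →ₗ[k] H := HopfAlgebra.antipode k
  have hS : ∀ a b : H, S (a * b) = S b * S a := HopfAlgebra.antipode_mul_antidistrib
  -- the linear map `a ⊗ b ↦ S(a) w b`
  let L : H → H ⊗[k] H →ₗ[k] H := fun w =>
    LinearMap.mul' k H ∘ₗ (LinearMap.mulRight k w ∘ₗ S).rTensor H
  have hL : ∀ w a b, L w (a ⊗ₜ[k] b) = S a * w * b := fun w a b => rfl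
  have hL0 : ∀ Z, L 0 Z = 0 := by
    intro Z
    induction Z with
    | zero => simp
    | tmul a b => simp [hL]
    | add a b ha hb => rw [map_add, ha, hb, add_zero]
  have hLadd : ∀ w w' Z, L (w + w') Z = L w Z + L w' Z := by
    intro w w' Z
    induction Z with
    | zero => simp
    | tmul a b => simp [hL, mul_add, add_mul]
    | add a b ha hb => rw [map_add, ha, hb, map_add, map_add]; abel
  have hLmul : ∀ w Z Z', L w (Z * Z') = L (L w Z) Z' := by
    intro w Z Z'
    induction Z with
    | zero => simp [hL0]
    | add a b ha hb => rw [add_mul, map_add, map_add, hLadd, ha, hb]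
    | tmul a b =>
      induction Z' with
      | zero => simp
      | add c d hc hd => rw [mul_add, map_add, map_add, hc, hd]
      | tmul c d => simp [hL, hS, mul_assoc]
  have hU : ∀ Z, LinearMap.mul' k H (J.twistedAntipode.rTensor H Z) =
      J.antipodeUnit * L J.antipodeUnitInv Z := by
    intro Z
    induction Z with
    | zero => simp
    | add a b ha hb => simp only [map_add, ha, hb, mul_add]
    | tmul a b => simp [hL, twistedAntipode, S, mul_assoc]
  have h1 : ∀ Z, L 1 Z = LinearMap.mul' k H (S.rTensor H Z) := by
    intro Z
    simp [L, LinearMap.mulRight_one]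
  have hLone : ∀ w, L w 1 = w := by
    intro w
    rw [Algebra.TensorProduct.one_def, hL]
    simp [S]
  have hLs : ∀ (c : k) (Z), L (algebraMap k H c) Z = c • L 1 Z := by
    intro c Z
    induction Z with
    | zero => simp
    | tmul a b => simp [hL, Algebra.algebraMap_eq_smul_one]
    | add a b ha hb => rw [map_add, ha, hb, map_add, smul_add]
  have hV : J.antipodeUnitInv = L 1 ((J.val⁻¹ : (H ⊗[k] H)ˣ) : H ⊗[k] H) := (h1 _).symm
  have hx : L 1 (Bialgebra.comulAlgHom k H x) = algebraMap k H (Coalgebra.counit (R := k) x) := by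
    rw [h1]
    exact HopfAlgebra.mul_antipode_rTensor_comul_apply x
  rw [hU, twistedComul_apply, hLmul, hLmul]
  conv_lhs => rw [hV]
  rw [← hLmul 1 _ (J.val : H ⊗[k] H), Units.inv_mul, hLone, hx, hLs, ← hV, mul_smul_comm,
    antipodeUnit_mul_inv, Algebra.algebraMap_eq_smul_one]

lemma twistedAntipode_right (x : H) :
    LinearMap.mul' k H (J.twistedAntipode.lTensor H (J.twistedComul x)) =
      algebraMap k H (Coalgebra.counit (R := k) x) := by
  let S : H →ₗ[k] H := HopfAlgebra.antipode k
  have hS : ∀ a b : H, S (a * b) = S b * S a := HopfAlgebra.antipode_mul_antidistrib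
  -- the linear map `a ⊗ b ↦ a w S(b)`
  let R : H → H ⊗[k] H →ₗ[k] H := fun w =>
    LinearMap.mul' k H ∘ₗ (LinearMap.mulLeft k w ∘ₗ S).lTensor H
  have hR : ∀ w a b, R w (a ⊗ₜ[k] b) = a * (w * S b) := fun w a b => rfl
  have hR0 : ∀ Z, R 0 Z = 0 := by
    intro Z
    induction Z with
    | zero => simp
    | tmul a b => simp [hR]
    | add a b ha hb => rw [map_add, ha, hb, add_zero]
  have hRadd : ∀ w w' Z, R (w + w') Z = R w Z + R w' Z := by
    intro w w' Z
    induction Z with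
    | zero => simp
    | tmul a b => simp [hR, mul_add, add_mul]
    | add a b ha hb => rw [map_add, ha, hb, map_add, map_add]; abel
  have hRmul : ∀ w Z Z', R w (Z * Z') = R (R w Z') Z := by
    intro w Z Z'
    induction Z' with
    | zero => simp [hR0]
    | add a b ha hb => rw [mul_add, map_add, map_add, hRadd, ha, hb]
    | tmul a b =>
      induction Z with
      | zero => simp
      | add c d hc hd => rw [add_mul, map_add, map_add, hc, hd]
      | tmul c d => simp [hR, hS, mul_assoc]
  have hU : ∀ Z, LinearMap.mul' k H (J.twistedAntipode.lTensor H Z) =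
      R J.antipodeUnit Z * J.antipodeUnitInv := by
    intro Z
    induction Z with
    | zero => simp
    | add a b ha hb => simp only [map_add, ha, hb, add_mul]
    | tmul a b => simp [hR, twistedAntipode, S, mul_assoc]
  have h1 : ∀ Z, R 1 Z = LinearMap.mul' k H (S.lTensor H Z) := by
    intro Z
    simp [R, LinearMap.mulLeft_one]
  have hRone : ∀ w, R w 1 = w := by
    intro w
    rw [Algebra.TensorProduct.one_def, hR]
    simp [S]
  have hRs : ∀ (c : k) (Z), R (algebraMap k H c) Z = c • R 1 Z := by
    intro c Z
    induction Z with
    | zero => simp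
    | tmul a b => simp [hR, Algebra.algebraMap_eq_smul_one]
    | add a b ha hb => rw [map_add, ha, hb, map_add, smul_add]
  have hV : J.antipodeUnit = R 1 (J.val : H ⊗[k] H) := (h1 _).symm
  have hx : R 1 (Bialgebra.comulAlgHom k H x) = algebraMap k H (Coalgebra.counit (R := k) x) := by
    rw [h1]
    exact HopfAlgebra.mul_antipode_lTensor_comul_apply x
  rw [hU, twistedComul_apply, hRmul, hRmul]
  conv_lhs => rw [hV]
  rw [← hRmul 1 ((J.val⁻¹ : (H ⊗[k] H)ˣ) : H ⊗[k] H), Units.inv_mul, hRone, hx, hRs, ← hV,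
    smul_mul_assoc, antipodeUnit_mul_inv, Algebra.algebraMap_eq_smul_one]

instance : Coalgebra k J.Twisted where
  comul := J.twistedComul.toLinearMap
  counit := Coalgebra.counit (R := k) (A := H)
  coassoc := LinearMap.ext J.twistedComul_coassoc
  rTensor_counit_comp_comul := LinearMap.ext J.twistedComul_counit_left
  lTensor_counit_comp_comul := LinearMap.ext J.twistedComul_counit_right

instance : Bialgebra k J.Twisted :=
  Bialgebra.mk' k J.Twisted
    (map_one (Bialgebra.counitAlgHom k H))
    (fun {a b} => map_mul (Bialgebra.counitAlgHom k H) a b)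
    (map_one J.twistedComul)
    (fun {a b} => map_mul J.twistedComul a b)

/-- The twisted Hopf algebra `H^J`: the algebra `H` with comultiplication `J Δ(x) J⁻¹`, the
counit of `H` and antipode `U S(x) U⁻¹`. -/
instance : HopfAlgebra k J.Twisted where
  antipode := J.twistedAntipode
  mul_antipode_rTensor_comul := LinearMap.ext J.twistedAntipode_left
  mul_antipode_lTensor_comul := LinearMap.ext J.twistedAntipode_right

instance [FiniteDimensional k H] : FiniteDimensional k J.Twisted :=
  inferInstanceAs (FiniteDimensional k H)

lemma map_twistedComul (φ : H →ₐc[k] H') (x : H) :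
    Algebra.TensorProduct.map (φ : H →ₐ[k] H') (φ : H →ₐ[k] H') (J.twistedComul x) =
      (J.map φ).twistedComul (φ x) := by
  have hφ : Algebra.TensorProduct.map (φ : H →ₐ[k] H') (φ : H →ₐ[k] H')
      (Bialgebra.comulAlgHom k H x) = Bialgebra.comulAlgHom k H' (φ x) :=
    DFunLike.congr_fun (BialgHomClass.map_comp_comulAlgHom φ) x
  rw [twistedComul_apply, twistedComul_apply, map_mul, map_mul, hφ]
  rfl

/-- A homomorphism of Hopf algebras `φ : H → H'` is also one from `H^J` to `H'^((φ ⊗ φ)(J))`. -/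
def twistedMap (φ : H →ₐc[k] H') : J.Twisted →ₐc[k] (J.map φ).Twisted :=
  BialgHom.ofAlgHom (A := J.Twisted) (B := (J.map φ).Twisted) (φ : H →ₐ[k] H')
    (BialgHomClass.counitAlgHom_comp φ)
    (AlgHom.ext (J.map_twistedComul φ))

end HopfTwist

end Twisting

/-! ### The dual of a finite dimensional Hopf algebra, normality and conormality -/

section Conormality

open Module

variable {k : Type*} [Field k] {K K' : Type*} [Ring K] [HopfAlgebra k K] [Ring K']
  [HopfAlgebra k K']

/-- The multiplication of the dual Hopf algebra `K*`: `(f g)(x) = f(x₁) g(x₂)`. -/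
def dualMul (k K : Type*) [Field k] [Ring K] [HopfAlgebra k K] :
    Dual k K →ₗ[k] Dual k K →ₗ[k] Dual k K :=
  TensorProduct.curry
    ((Coalgebra.comul (R := k) (A := K)).dualMap ∘ₗ TensorProduct.dualDistrib k K K)

/-- The comultiplication of the dual Hopf algebra `K*` of a finite dimensional `K`:
`f₁(x) f₂(y) = f(x y)`. -/
def dualComul (k K : Type*) [Field k] [Ring K] [HopfAlgebra k K] [FiniteDimensional k K] :
    Dual k K →ₗ[k] Dual k K ⊗[k] Dual k K :=
  (TensorProduct.dualDistribEquiv k K K).symm.toLinearMap ∘ₗ (LinearMap.mul' k K).dualMap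

/-- The antipode of the dual Hopf algebra `K*`. -/
def dualAntipode (k K : Type*) [Field k] [Ring K] [HopfAlgebra k K] :
    Dual k K →ₗ[k] Dual k K :=
  (HopfAlgebra.antipode k (A := K)).dualMap

/-- The left adjoint action of `K*` on itself: `f ⬝ g = f₁ g S(f₂)`. -/
def dualAdjointLeft [FiniteDimensional k K] (f g : Dual k K) : Dual k K :=
  TensorProduct.lift
    (((dualMul k K).compl₂ (dualAntipode k K)) ∘ₗ (dualMul k K).flip g) (dualComul k K f)

/-- The right adjoint action of `K*` on itself: `g ⬝ f = S(f₁) g f₂`. -/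
def dualAdjointRight [FiniteDimensional k K] (f g : Dual k K) : Dual k K :=
  TensorProduct.lift
    (dualMul k K ∘ₗ (dualMul k K).flip g ∘ₗ dualAntipode k K) (dualComul k K f)

/-- A subspace of the dual Hopf algebra `K*` that is stable under both adjoint actions; a Hopf
subalgebra of `K*` with this property is called normal. -/
def IsNormalInDual [FiniteDimensional k K] (W : Submodule k (Dual k K)) : Prop :=
  ∀ f : Dual k K, ∀ g ∈ W, dualAdjointLeft f g ∈ W ∧ dualAdjointRight f g ∈ W

/-- A quotient `π : K → K'` of finite dimensional Hopf algebras is conormal if it is dual to a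
normal inclusion: it is surjective, and the image of the inclusion `π* : K'* → K*` is a normal
Hopf subalgebra of `K*` (the image of `π*` is always a Hopf subalgebra). -/
def IsConormal [FiniteDimensional k K] (π : K →ₐc[k] K') : Prop :=
  Function.Surjective π ∧
    IsNormalInDual (LinearMap.range ((π : K →ₐ[k] K').toLinearMap.dualMap))

end Conormality

/-! ### Galois objects over `k^G` and the Miyashita-Ulbrich action -/

section Galois

variable (k G A : Type*) [Field k] [Group G] [Fintype G] [DecidableEq G]
  [Ring A] [Algebra k A] [MulSemiringAction G A] [SMulCommClass G k A]

/-- The coaction `ρ : A → A ⊗ k^G`, `ρ(a) = ∑ g, g.a ⊗ e_g` of the Hopf algebra `k^G` of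
functions on `G` on a `G`-algebra `A`. -/
def galoisCoaction : A →ₗ[k] A ⊗[k] (G → k) :=
  ∑ g : G, (TensorProduct.mk k A (G → k)).flip (Pi.single g 1) ∘ₗ
    DistribSMul.toLinearMap k A g

/-- The canonical map `A ⊗ A → A ⊗ k^G`, `x ⊗ y ↦ x y₀ ⊗ y₁`. -/
def galoisCan : A ⊗[k] A →ₗ[k] A ⊗[k] (G → k) :=
  (LinearMap.mul' k A).rTensor (G → k) ∘ₗ
    (TensorProduct.assoc k A A (G → k)).symm.toLinearMap ∘ₗ
    (galoisCoaction k G A).lTensor A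

/-- The `G`-algebra `A` is a (right) `k^G`-Galois object: a `k^G`-Galois extension of `k`. -/
structure IsGaloisObject : Prop where
  nontrivial : Nontrivial A
  coinvariants : ∀ a : A,
    galoisCoaction k G A a = a ⊗ₜ[k] (1 : G → k) ↔ a ∈ (⊥ : Subalgebra k A)
  can_bijective : Function.Bijective (galoisCan k G A)

variable {A}

/-- The linear map `A ⊗ A → A`, `a ⊗ b ↦ a x b`. -/
def sandwich (x : A) : A ⊗[k] A →ₗ[k] A :=
  TensorProduct.lift (LinearMap.mul k A ∘ₗ LinearMap.mulRight k x)

/-- The Miyashita-Ulbrich action `x ↼ h = h^[1] x h^[2]` of `h ∈ k^G` on an element `x` of the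
Galois object `A`, where `can (h^[1] ⊗ h^[2]) = 1 ⊗ h`, that is, `h^[1] ⊗ h^[2]` is the preimage
of `1 ⊗ h` under the bijective map `can`. -/
def miyashitaUlbrich (x : A) (h : G → k) : A :=
  sandwich k x (Function.invFun (galoisCan k G A) ((1 : A) ⊗ₜ[k] h))

variable {k}

/-- The subspace `W` is a `k^G`-submodule of `A` with respect to the Miyashita-Ulbrich action. -/
def IsMiyashitaUlbrichStable (W : Submodule k A) : Prop :=
  ∀ x ∈ W, ∀ h : G → k, miyashitaUlbrich k G x h ∈ W

variable (k) {G} (A)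

/-- The subspace `A^F` of `F`-invariants. -/
def fixedSubspace (F : Subgroup G) : Submodule k A where
  carrier := {a | ∀ g ∈ F, g • a = a}
  zero_mem' := fun g _ => smul_zero g
  add_mem' := fun ha hb g hg => by rw [smul_add, ha g hg, hb g hg]
  smul_mem' := fun c a ha g hg => by rw [smul_comm, ha g hg]

end Galois

/-! ### Twisted group algebras -/

section TwistedGroupAlgebra

/-- A `2`-cocycle on the group `S` with values in `kˣ` (with trivial action). -/
structure TwoCocycle (S k : Type*) [Group S] [Field k] where
  /-- the underlying function -/
  toFun : S → S → kˣ
  cocycle : ∀ s t u : S, toFun s t * toFun (s * t) u = toFun t u * toFun s (t * u)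

namespace TwoCocycle

variable {S k : Type*} [Group S] [Field k] (α : TwoCocycle S k)

/-- An element `s` is `α`-regular if `α(s,t) = α(t,s)` for all `t` in the centralizer of `s`. -/
def IsRegular (s : S) : Prop := ∀ t : S, s * t = t * s → α.toFun s t = α.toFun t s

/-- The cocycle `α` is non-degenerate if the identity is the only `α`-regular element. -/
def IsNondegenerate : Prop := ∀ s : S, α.IsRegular s ↔ s = 1

lemma toFun_one_left (s : S) : α.toFun 1 s = α.toFun 1 1 := by
  have h := α.cocycle 1 1 s
  simp only [one_mul] at h
  exact (mul_right_cancel h).symm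

lemma toFun_one_right (s : S) : α.toFun s 1 = α.toFun 1 1 := by
  have h := α.cocycle s 1 1
  simp only [mul_one] at h
  exact mul_right_cancel h

lemma toFun_inv_comm (s : S) : α.toFun s⁻¹ s = α.toFun s s⁻¹ := by
  have h := α.cocycle s s⁻¹ s
  rw [mul_inv_cancel, inv_mul_cancel, toFun_one_left, toFun_one_right α s] at h
  exact (mul_right_cancel h).symm

/-- The twisted group algebra `k_α S`: the vector space with basis `x_s`, `s ∈ S`, and
multiplication `x_s x_t = α(s,t) x_{st}`. Its unit is `α(1,1)⁻¹ x_1`. -/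
def TwistedGroupAlgebra (_α : TwoCocycle S k) : Type _ := S →₀ k

namespace TwistedGroupAlgebra

instance : AddCommGroup α.TwistedGroupAlgebra := inferInstanceAs (AddCommGroup (S →₀ k))

instance : Module k α.TwistedGroupAlgebra := inferInstanceAs (Module k (S →₀ k))

/-- The standard basis `(x_s)` of the twisted group algebra. -/
def basis : Module.Basis S k α.TwistedGroupAlgebra :=
  Module.Basis.ofRepr (LinearEquiv.refl k (S →₀ k) : α.TwistedGroupAlgebra ≃ₗ[k] (S →₀ k))

/-- The basis vector `x_s` of the twisted group algebra. -/
def x (s : S) : α.TwistedGroupAlgebra := basis α s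

/-- The multiplication of the twisted group algebra, as a bilinear map. -/
def mulMap : α.TwistedGroupAlgebra →ₗ[k] α.TwistedGroupAlgebra →ₗ[k] α.TwistedGroupAlgebra :=
  (basis α).constr k fun s => (basis α).constr k fun t => (α.toFun s t : k) • x α (s * t)

instance : Mul α.TwistedGroupAlgebra := ⟨fun a b => mulMap α a b⟩

instance : One α.TwistedGroupAlgebra := ⟨((α.toFun 1 1)⁻¹ : kˣ).val • x α 1⟩

lemma mul_def (a b : α.TwistedGroupAlgebra) : a * b = mulMap α a b := rfl

lemma one_def : (1 : α.TwistedGroupAlgebra) = ((α.toFun 1 1)⁻¹ : kˣ).val • x α 1 := rfl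

lemma x_mul_x (s t : S) : x α s * x α t = (α.toFun s t : k) • x α (s * t) := by
  rw [mul_def, mulMap, x, x, Module.Basis.constr_basis, Module.Basis.constr_basis]

/-- Two linear maps on the twisted group algebra agree if they agree on the basis `x_s`. -/
lemma hom_ext {M : Type*} [AddCommMonoid M] [Module k M] {f g : α.TwistedGroupAlgebra →ₗ[k] M}
    (h : ∀ s, f (x α s) = g (x α s)) : f = g :=
  (basis α).ext h

lemma mulMap_one (a : α.TwistedGroupAlgebra) : mulMap α a 1 = a := by
  have : (mulMap α).flip 1 = LinearMap.id := by
    refine hom_ext α fun s => ?_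
    rw [LinearMap.flip_apply, one_def, map_smul, ← mul_def, x_mul_x, mul_one, toFun_one_right α s,
      smul_smul, ← Units.val_mul, inv_mul_cancel, Units.val_one, one_smul, LinearMap.id_apply]
  exact LinearMap.congr_fun this a

lemma one_mulMap (a : α.TwistedGroupAlgebra) : mulMap α 1 a = a := by
  have : mulMap α 1 = LinearMap.id := by
    refine hom_ext α fun s => ?_
    rw [one_def, map_smul, LinearMap.smul_apply, ← mul_def, x_mul_x, one_mul, toFun_one_left α s,
      smul_smul, ← Units.val_mul, inv_mul_cancel, Units.val_one, one_smul, LinearMap.id_apply]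
  exact LinearMap.congr_fun this a

lemma mulMap_assoc (a b c : α.TwistedGroupAlgebra) :
    mulMap α (mulMap α a b) c = mulMap α a (mulMap α b c) := by
  have : (mulMap α).compr₂ (mulMap α) =
      ((LinearMap.llcomp k _ _ _).flip ∘ₗ mulMap α).flip ∘ₗ mulMap α := by
    refine hom_ext α fun s => hom_ext α fun t => hom_ext α fun u => ?_
    change x α s * x α t * x α u = x α s * (x α t * x α u)
    simp only [x_mul_x]
    rw [mul_def, map_smul, LinearMap.smul_apply, mul_def, map_smul, ← mul_def, ← mul_def,
      x_mul_x, x_mul_x, smul_smul, smul_smul, ← Units.val_mul, ← Units.val_mul, α.cocycle,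
      mul_assoc]
  exact LinearMap.congr_fun (LinearMap.congr_fun (LinearMap.congr_fun this a) b) c

instance : Ring α.TwistedGroupAlgebra :=
  { (inferInstance : AddCommGroup α.TwistedGroupAlgebra),
    (inferInstance : Mul α.TwistedGroupAlgebra),
    (inferInstance : One α.TwistedGroupAlgebra) with
    left_distrib := fun a b c => map_add (mulMap α a) b c
    right_distrib := fun a b c => LinearMap.map_add₂ (mulMap α) a b c
    zero_mul := fun a => LinearMap.map_zero₂ (mulMap α) a
    mul_zero := fun a => map_zero (mulMap α a)
    mul_assoc := mulMap_assoc α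
    one_mul := one_mulMap α
    mul_one := mulMap_one α }

instance : Algebra k α.TwistedGroupAlgebra :=
  Algebra.ofModule (fun r a b => LinearMap.map_smul₂ (mulMap α) r a b)
    (fun r a b => map_smul (mulMap α a) r b)

/-- The basis vector `x_s` as a unit of the twisted group algebra. -/
def xUnit (s : S) : (α.TwistedGroupAlgebra)ˣ where
  val := x α s
  inv := ((α.toFun s s⁻¹ * α.toFun 1 1)⁻¹ : kˣ).val • x α s⁻¹
  val_inv := by
    rw [mul_smul_comm, x_mul_x, mul_inv_cancel, one_def, smul_smul, ← Units.val_mul,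
      mul_inv_rev, mul_assoc, inv_mul_cancel, mul_one]
  inv_val := by
    rw [smul_mul_assoc, x_mul_x, inv_mul_cancel, one_def, smul_smul, ← Units.val_mul,
      toFun_inv_comm, mul_inv_rev, mul_assoc, inv_mul_cancel, mul_one]

/-- The action `s ▷ b = x_s b x_s⁻¹` of `S` on the twisted group algebra. -/
def conj (s : S) (b : α.TwistedGroupAlgebra) : α.TwistedGroupAlgebra :=
  (xUnit α s : α.TwistedGroupAlgebra) * b * ((xUnit α s)⁻¹ : (α.TwistedGroupAlgebra)ˣ)

end TwistedGroupAlgebra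

end TwoCocycle

end TwistedGroupAlgebra

/-! ### The Galois object `A(G, S, α)` -/

section GaloisObject

variable {k G : Type*} [Field k] [Group G] {S : Subgroup G}

open TwoCocycle.TwistedGroupAlgebra in
/-- The algebra `A(G, S, α)` of functions `f : G → k_α S` with `f(s g) = s ▷ f(g)` for all
`s ∈ S`, `g ∈ G`, with pointwise operations. -/
def galoisObject (α : TwoCocycle S k) : Subalgebra k (G → α.TwistedGroupAlgebra) where
  carrier := {f | ∀ (s : S) (g : G), f (s * g) = conj α s (f g)}
  mul_mem' := fun {a b} ha hb s g => by
    rw [Pi.mul_apply, Pi.mul_apply, ha, hb]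
    simp only [conj, mul_assoc, Units.inv_mul_cancel_left]
  add_mem' := fun {a b} ha hb s g => by
    rw [Pi.add_apply, Pi.add_apply, ha, hb]
    simp only [conj, mul_add, add_mul]
  algebraMap_mem' := fun r s g => by
    simp only [Pi.algebraMap_apply, conj]
    rw [← Algebra.commutes, mul_assoc, Units.mul_inv, mul_one]

variable (α : TwoCocycle S k)

/-- The action `(g.f)(h) = f(h g)` of `G` on `A(G, S, α)`. -/
instance : SMul G (galoisObject α) where
  smul g f := ⟨fun h => f.1 (h * g), fun s h => by
    have := f.2 s (h * g)
    rwa [← mul_assoc] at this⟩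

lemma galoisObject_smul_apply (g h : G) (f : galoisObject α) : (g • f).1 h = f.1 (h * g) := rfl

instance : MulSemiringAction G (galoisObject α) where
  one_smul f := Subtype.ext <| funext fun h => by rw [galoisObject_smul_apply, mul_one]
  mul_smul g g' f := Subtype.ext <| funext fun h => by
    simp only [galoisObject_smul_apply, mul_assoc]
  smul_zero _ := rfl
  smul_add _ _ _ := rfl
  smul_one _ := rfl
  smul_mul _ _ _ := rfl

instance : SMulCommClass G k (galoisObject α) where
  smul_comm _ _ _ := rfl

end GaloisObject

/-! ### Twists of group algebras -/

section GroupTwist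

open Module

variable {k G : Type*} [Field k] [Group G]

/-- The multiplication of the crossed product `(k^G)^{(J)}`: the space `k^G = (kG)*` with
`(f f')(x) = (f ⊗ f')(J Δ(x))`, that is, `f f' = J(f₁, f'₁) f₂ f'₂`. -/
def crossedMul (J : HopfTwist k (MonoidAlgebra k G)) (f f' : Dual k (MonoidAlgebra k G)) :
    Dual k (MonoidAlgebra k G) :=
  TensorProduct.dualDistrib k _ _ (f ⊗ₜ[k] f') ∘ₗ
    LinearMap.mulLeft k (J.val : MonoidAlgebra k G ⊗[k] MonoidAlgebra k G) ∘ₗ Coalgebra.comul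

/-- The twist `J` corresponds to the `G`-algebra `A`, if `A` is isomorphic to the crossed product
`(k^G)^{(J)}` as a `k^G`-comodule algebra, that is, as an algebra with `G`-action, where `G` acts
on `k^G = (kG)*` by `(g.f)(x) = f(x g)`. -/
def HopfTwist.CorrespondsTo (J : HopfTwist k (MonoidAlgebra k G)) (A : Type*) [Ring A]
    [Algebra k A] [MulSemiringAction G A] : Prop :=
  ∃ e : A ≃ₗ[k] Dual k (MonoidAlgebra k G),
    e 1 = Coalgebra.counit ∧
    (∀ a b : A, e (a * b) = crossedMul J (e a) (e b)) ∧
    ∀ (g : G) (a : A) (x : MonoidAlgebra k G),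
      e (g • a) x = e a (x * MonoidAlgebra.single g 1)

/-- The subalgebra `kF ⊗ kF` of `kG ⊗ kG`, for a subgroup `F` of `G`. -/
def subgroupTensor (k : Type*) {G : Type*} [Field k] [Group G] (F : Subgroup G) :
    Subalgebra k (MonoidAlgebra k G ⊗[k] MonoidAlgebra k G) :=
  (Algebra.TensorProduct.map (MonoidAlgebra.mapDomainAlgHom k k F.subtype)
    (MonoidAlgebra.mapDomainAlgHom k k F.subtype)).range

/-- The quotient map `(kG)^J → k(G/F)^{J̄}`, where `J̄` is the image of `J` under `kG → k(G/F)`. -/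
def twistedQuotient (J : HopfTwist k (MonoidAlgebra k G)) (F : Subgroup G) [F.Normal] :
    J.Twisted →ₐc[k] (J.map (MonoidAlgebra.mapDomainBialgHom k (QuotientGroup.mk' F))).Twisted :=
  J.twistedMap (MonoidAlgebra.mapDomainBialgHom k (QuotientGroup.mk' F))

end GroupTwist

end

/-
Non-degeneracy of `α` forces `|S| ≠ 0` in `k`, and averaging over conjugation by `S` kills every
`x_t` with `t ≠ 1`. This yields explicit preimages of `1 ⊗ e_g` under the canonical map, and with
them the formula `(a ↼ h)(u) = ∑_{s ∈ S} h(u⁻¹su) a(u)_s x_s`, where `a(u)_s` is the coordinate of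
`a(u)` at `x_s`.

If `S ≤ F`, then `F`-fixed functions are scalar-valued, so `↼ h` acts on them as the scalar `h(1)`.
Conversely, suppose that `A^F` is stable and that `x_t` with `t ≠ 1` survives averaging over
`S ∩ F`. Testing the formula on the average shows that `F` centralizes `t`; as the index of `F` is
prime and `Z(G) = 1`, the centralizer of `t` is `F`, which contradicts the non-degeneracy at `t`.
Hence averaging over `S ∩ F` is proportional to averaging over `S`, and since the conjugations by
the elements of `S` are linearly independent, `S ∩ F = S`.

If `J ∈ kF ⊗ kF`, then the functionals factoring through `k(G/F)` are central in `((kG)^J)*`, so the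
quotient is conormal. Conversely, under `A ≅ (kG)*` the action `(a.y)(x) = a(yx)` makes `A` a right
module algebra over `(kG)^J`, and `y` acts on `x ↼ h = h^[1] x h^[2]` through the right coadjoint
coaction `y₂ ⊗ S(y₁) y₃`. Normality of the functionals factoring through `k(G/F)` therefore makes
`A^F` stable.
-/

noncomputable section

section TwistedGroupAlgebraConjugation

lemma natCast_card_subgroup_ne_zero {k G : Type*} [Field k] [Group G] [Fintype G]
    (hG : (Fintype.card G : k) ≠ 0) (H : Subgroup G) [Fintype H] : (Fintype.card H : k) ≠ 0 := by
  obtain ⟨m, hm⟩ := H.card_subgroup_dvd_card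
  rw [Nat.card_eq_fintype_card, Nat.card_eq_fintype_card] at hm
  exact left_ne_zero_of_mul (by rwa [← Nat.cast_mul, ← hm])

namespace TwoCocycle

namespace TwistedGroupAlgebra

variable {S k : Type*} [Group S] [Field k] (α : TwoCocycle S k)

/-- The inverse of `x_s` in `k_α S`, a multiple of `x_{s⁻¹}`. -/
def xInv (s : S) : α.TwistedGroupAlgebra := ((xUnit α s)⁻¹ : (α.TwistedGroupAlgebra)ˣ)

lemma conj_eq (s : S) (b : α.TwistedGroupAlgebra) : conj α s b = x α s * b * xInv α s := rfl

lemma exists_xInv_eq_smul (s : S) : ∃ c : k, xInv α s = c • x α s⁻¹ := ⟨_, rfl⟩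

@[simp] lemma x_mul_xInv (s : S) : x α s * xInv α s = 1 := (xUnit α s).mul_inv

@[simp] lemma x_mul_xInv_mul (s : S) (b : α.TwistedGroupAlgebra) :
    x α s * (xInv α s * b) = b := (xUnit α s).mul_inv_cancel_left b

@[simp] lemma xInv_mul_x (s : S) : xInv α s * x α s = 1 := (xUnit α s).inv_mul

@[simp] lemma xInv_mul_x_mul (s : S) (b : α.TwistedGroupAlgebra) :
    xInv α s * (x α s * b) = b := (xUnit α s).inv_mul_cancel_left b

lemma x_one : x α 1 = (α.toFun 1 1 : k) • (1 : α.TwistedGroupAlgebra) := by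
  rw [one_def, smul_smul, ← Units.val_mul, mul_inv_cancel, Units.val_one, one_smul]

lemma x_ne_zero (s : S) : x α s ≠ 0 := (basis α).ne_zero s

instance : Nontrivial α.TwistedGroupAlgebra := ⟨x α 1, 0, x_ne_zero α 1⟩

@[simp] lemma repr_x [DecidableEq S] (s t : S) :
    (basis α).repr (x α s) t = if s = t then 1 else 0 := by
  rw [x, Module.Basis.repr_self, Finsupp.single_apply]

lemma repr_one_smul_x [DecidableEq S] (s : S) :
    (basis α).repr 1 s • x α s = if s = 1 then 1 else 0 := by
  split_ifs with h
  · rw [h, one_def, map_smul, Finsupp.smul_apply, repr_x, if_pos rfl, smul_eq_mul, mul_one]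
  · rw [one_def, map_smul, Finsupp.smul_apply, repr_x, if_neg (Ne.symm h), smul_zero, zero_smul]

lemma conj_eq_iff (s : S) (b c : α.TwistedGroupAlgebra) :
    conj α s b = c ↔ x α s * b = c * x α s :=
  Units.mul_inv_eq_iff_eq_mul _

lemma conj_mul_x (s : S) (b : α.TwistedGroupAlgebra) : conj α s b * x α s = x α s * b :=
  ((conj_eq_iff α s b _).1 rfl).symm

lemma conj_mul (s : S) (b c : α.TwistedGroupAlgebra) :
    conj α s (b * c) = conj α s b * conj α s c := by
  simp only [conj_eq, mul_assoc, xInv_mul_x_mul]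

/-- The conjugation action of `S` on `k_α S`, as a linear representation. -/
def conjRep : Representation k S α.TwistedGroupAlgebra where
  toFun s := LinearMap.mulRight k (xInv α s) ∘ₗ LinearMap.mulLeft k (x α s)
  map_one' := LinearMap.ext fun b => (conj_eq_iff α 1 b b).2 <| by
    rw [x_one, smul_mul_assoc, mul_smul_comm, one_mul, mul_one]
  map_mul' s t := LinearMap.ext fun b => (conj_eq_iff α (s * t) b _).2 <| by
    have h : x α (s * t) = ((α.toFun s t)⁻¹ : kˣ).val • (x α s * x α t) := by
      rw [x_mul_x, smul_smul, ← Units.val_mul, inv_mul_cancel, Units.val_one, one_smul]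
    change x α (s * t) * b = conj α s (conj α t b) * x α (s * t)
    rw [h, smul_mul_assoc, mul_smul_comm, ← mul_assoc, conj_mul_x, mul_assoc, mul_assoc,
      conj_mul_x]

@[simp] lemma conjRep_apply (s : S) (b : α.TwistedGroupAlgebra) : conjRep α s b = conj α s b := rfl

@[simp] lemma conj_one_right (s : S) : conj α s 1 = 1 := by simp [conj_eq_iff]

@[simp] lemma conj_one_left (b : α.TwistedGroupAlgebra) : conj α 1 b = b :=
  LinearMap.congr_fun (conjRep α).map_one b

lemma conj_mul_left (s t : S) (b : α.TwistedGroupAlgebra) :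
    conj α (s * t) b = conj α s (conj α t b) :=
  LinearMap.congr_fun ((conjRep α).map_mul s t) b

lemma conj_smul (s : S) (c : k) (b : α.TwistedGroupAlgebra) :
    conj α s (c • b) = c • conj α s b := map_smul (conjRep α s) c b

lemma exists_conj_x (s t : S) : ∃ c : k, conj α s (x α t) = c • x α (s * t * s⁻¹) := by
  refine ⟨((α.toFun (s * t * s⁻¹) s)⁻¹ * α.toFun s t : kˣ), ?_⟩
  rw [conj_eq_iff, smul_mul_assoc, x_mul_x, x_mul_x, inv_mul_cancel_right, smul_smul,
    ← Units.val_mul, mul_right_comm, inv_mul_cancel, one_mul]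

variable {α} in
lemma conj_x_of_commute {s t : S} (h : s * t = t * s) :
    conj α s (x α t) = (α.toFun s t * (α.toFun t s)⁻¹ : kˣ).val • x α t := by
  rw [conj_eq_iff, smul_mul_assoc, x_mul_x, x_mul_x, h, smul_smul, ← Units.val_mul,
    inv_mul_cancel_right]

variable {α}

lemma conj_x_eq_self_iff {s t : S} (h : s * t = t * s) :
    conj α s (x α t) = x α t ↔ α.toFun s t = α.toFun t s := by
  have hsmul (c : k) : c • x α t = x α t ↔ c = 1 := by
    rw [← (smul_left_injective k (x_ne_zero α t)).eq_iff, one_smul]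
  rw [conj_x_of_commute h, hsmul, Units.val_eq_one, mul_inv_eq_one]

lemma exists_conj_x_ne (hα : α.IsNondegenerate) {t : S} (ht : t ≠ 1) :
    ∃ s, s * t = t * s ∧ conj α s (x α t) ≠ x α t := by
  by_contra! h
  exact ht ((hα t).1 fun s hs => ((conj_x_eq_self_iff hs.symm).1 (h s hs.symm)).symm)

lemma sum_conj_x_eq_zero {H : Type*} [Group H] [Fintype H] (φ : H →* S) {h : H} {t : S}
    (hcomm : φ h * t = t * φ h) (hne : conj α (φ h) (x α t) ≠ x α t) :
    ∑ h, conj α (φ h) (x α t) = 0 := by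
  set c := (α.toFun (φ h) t * (α.toFun t (φ h))⁻¹ : kˣ).val
  have hconj : conj α (φ h) (x α t) = c • x α t := conj_x_of_commute hcomm
  have hsum : ∑ h, conj α (φ h) (x α t) = c • ∑ h, conj α (φ h) (x α t) := by
    conv_lhs => rw [← Equiv.sum_comp (Equiv.mulRight h)]
    simp only [Equiv.coe_mulRight, map_mul, conj_mul_left, hconj, conj_smul, Finset.smul_sum]
  have hc : 1 - c ≠ 0 := sub_ne_zero.2 fun hc => hne (by rw [hconj, ← hc, one_smul])
  refine (smul_eq_zero.1 ?_).resolve_left hc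
  rw [sub_smul, one_smul, ← hsum, sub_self]

section Averaging

variable [Fintype S]

/-- If the characteristic `p` divided `|S|`, an element of order `p` would be regular, because the
field has no nontrivial `p`-th roots of unity. -/
lemma card_ne_zero_of_isNondegenerate (hα : α.IsNondegenerate) : (Fintype.card S : k) ≠ 0 := by
  intro h0
  obtain ⟨p, hp⟩ := CharP.exists k
  have hdvd : p ∣ Fintype.card S := (CharP.cast_eq_zero_iff k p _).1 h0
  have hp0 : p ≠ 0 := fun h => Fintype.card_ne_zero (Nat.eq_zero_of_zero_dvd (h ▸ hdvd))
  have : Fact p.Prime := ⟨(CharP.char_is_prime_or_zero k p).resolve_right hp0⟩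
  obtain ⟨s, hs⟩ := exists_prime_orderOf_dvd_card p hdvd
  have hreg : α.IsRegular s := fun t ht => (conj_x_eq_self_iff ht).1 <| by
    set c := (α.toFun s t * (α.toFun t s)⁻¹ : kˣ).val with hc
    have hpow : ∀ n : ℕ, conj α (s ^ n) (x α t) = c ^ n • x α t := fun n => by
      induction n with
      | zero => simp
      | succ n ih =>
        rw [pow_succ, conj_mul_left, conj_x_of_commute ht, conj_smul, ih, smul_smul, pow_succ']
    have hcp : c ^ p = 1 := smul_left_injective k (x_ne_zero α t) <| by
      simp only [← hpow, ← hs, pow_orderOf_eq_one, conj_one_left, one_smul]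
    have hc1 : c = 1 := frobenius_inj k p <| by simpa only [frobenius_def, one_pow] using hcp
    rw [conj_x_of_commute ht, ← hc, hc1, one_smul]
  rw [(hα s).1 hreg, orderOf_one] at hs
  exact (Fact.out : p.Prime).ne_one hs.symm

lemma norm_conjRep_x_of_ne (hα : α.IsNondegenerate) {t : S} (ht : t ≠ 1) :
    (conjRep α).norm (x α t) = 0 := by
  obtain ⟨s, hcomm, hne⟩ := exists_conj_x_ne hα ht
  simpa [Representation.norm] using sum_conj_x_eq_zero (MonoidHom.id S) hcomm hne

lemma norm_conjRep_one : (conjRep α).norm 1 = (Fintype.card S : k) • 1 := by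
  simp [Representation.norm, Nat.cast_smul_eq_nsmul]

lemma norm_conjRep_x_mul_xInv [DecidableEq S] (hα : α.IsNondegenerate) (s t : S) :
    (conjRep α).norm (x α s * xInv α t) = if s = t then (Fintype.card S : k) • 1 else 0 := by
  split_ifs with h
  · rw [h, x_mul_xInv, norm_conjRep_one]
  · obtain ⟨c, hc⟩ := exists_xInv_eq_smul α t
    rw [hc, mul_smul_comm, x_mul_x, map_smul, map_smul,
      norm_conjRep_x_of_ne hα (mul_inv_eq_one.not.2 h), smul_zero, smul_zero]

lemma norm_conjRep_mul_xInv_mul_x (hα : α.IsNondegenerate) (b : α.TwistedGroupAlgebra) (t : S) :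
    (conjRep α).norm (b * xInv α t) * x α t =
      ((Fintype.card S : k) * (basis α).repr b t) • x α t := by
  classical
  have hbasis (s : S) : basis α s = x α s := rfl
  conv_lhs => rw [← (basis α).sum_repr b]
  simp only [hbasis, Finset.sum_mul, map_sum, smul_mul_assoc, map_smul,
    norm_conjRep_x_mul_xInv hα]
  simp [smul_smul, mul_comm]

lemma sum_conj_x_mul_mul_conj_xInv (hα : α.IsNondegenerate) (s s' : S)
    (b : α.TwistedGroupAlgebra) : ∑ t, conj α s (x α t) * b * conj α s' (xInv α t) =
      ((Fintype.card S : k) * (basis α).repr b (s * s'⁻¹)) • x α (s * s'⁻¹) := by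
  set r := s * s'⁻¹ with hr
  have hterm (t : S) : conj α s (x α t) * b * conj α s' (xInv α t) =
      conj α s (conj α t (conj α s⁻¹ (b * xInv α r))) * x α r := by
    have hs : conj α s (xInv α t) = x α r * conj α s' (xInv α t) * xInv α r := by
      rw [← conj_eq, ← conj_mul_left, hr, inv_mul_cancel_right]
    rw [conj_eq α t, conj_mul, conj_mul, ← conj_mul_left, mul_inv_cancel, conj_one_left, hs]
    simp only [mul_assoc, xInv_mul_x, xInv_mul_x_mul, mul_one]
  rw [← norm_conjRep_mul_xInv_mul_x hα, ← (conjRep α).norm_self_apply s⁻¹,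
    ← (conjRep α).self_norm_apply s]
  simp only [hterm, ← Finset.sum_mul, Representation.norm, LinearMap.sum_apply, map_sum,
    conjRep_apply]

lemma card_smul_sum_conjRep_subgroup (hα : α.IsNondegenerate) {N : Subgroup S} [Fintype N]
    (hN : ∀ t, t ≠ 1 → ∃ n ∈ N, n * t = t * n ∧ conj α n (x α t) ≠ x α t) :
    (Fintype.card S : k) • ∑ n : N, conjRep α n = (Fintype.card N : k) • ∑ s, conjRep α s := by
  refine hom_ext α fun t => ?_
  by_cases ht : t = 1
  · simp [ht, x_one, ← Nat.cast_smul_eq_nsmul k, smul_smul, mul_comm]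
  · obtain ⟨n, hn, hcomm, hne⟩ := hN t ht
    have hsumN : (∑ n : N, conjRep α n) (x α t) = 0 := by
      simpa using sum_conj_x_eq_zero N.subtype (h := ⟨n, hn⟩) hcomm hne
    have hsumS : (∑ s, conjRep α s) (x α t) = 0 := norm_conjRep_x_of_ne hα ht
    rw [LinearMap.smul_apply, LinearMap.smul_apply, hsumN, hsumS, smul_zero, smul_zero]

end Averaging

variable [Finite S]

lemma eq_smul_one_of_conj_eq (hα : α.IsNondegenerate) {b : α.TwistedGroupAlgebra}
    (hb : ∀ s, conj α s b = b) : ∃ c : k, b = c • 1 := by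
  have := Fintype.ofFinite S
  refine ⟨(basis α).repr b 1 * α.toFun 1 1, smul_right_injective _
    (card_ne_zero_of_isNondegenerate hα) ?_⟩
  have hnorm : (conjRep α).norm (b * xInv α 1) = (Fintype.card S : k) • (b * xInv α 1) := by
    obtain ⟨c, hc⟩ := exists_xInv_eq_smul α 1
    simp [Representation.norm, hc, x_one, hb, ← Nat.cast_smul_eq_nsmul k, smul_smul,
      mul_comm]
  have h := norm_conjRep_mul_xInv_mul_x hα b 1
  rw [hnorm, smul_mul_assoc, mul_assoc, xInv_mul_x, mul_one, x_one] at h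
  simpa only [smul_smul, mul_assoc] using h

lemma linearIndependent_conjRep (hα : α.IsNondegenerate) : LinearIndependent k (conjRep α) := by
  classical
  have := Fintype.ofFinite S
  rw [Fintype.linearIndependent_iff]
  intro c hc v
  have hnorm (s : S) : (conjRep α).norm (xInv α s * x α v) =
      if v = s then (Fintype.card S : k) • 1 else 0 := by
    rw [← norm_conjRep_x_mul_xInv hα, ← (conjRep α).norm_self_apply s, conjRep_apply, conj_eq,
      x_mul_xInv_mul]
  have hsum (s : S) : ∑ t, conj α s (x α t) * (x α v * xInv α t) =
      if v = s then (Fintype.card S : k) • x α v else 0 := by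
    calc ∑ t, conj α s (x α t) * (x α v * xInv α t)
        = x α s * (conjRep α).norm (xInv α s * x α v) := by
          simp [Representation.norm, Finset.mul_sum, conj_eq, mul_assoc]
      _ = if v = s then (Fintype.card S : k) • x α v else 0 := by
          rw [hnorm, mul_ite, mul_zero, mul_smul_comm, mul_one]
          split_ifs with h
          · rw [h]
          · rfl
  have h : ∑ t, (∑ s, c s • conjRep α s) (x α t) * (x α v * xInv α t) =
      (c v * Fintype.card S : k) • x α v := by
    simp only [LinearMap.sum_apply, LinearMap.smul_apply, conjRep_apply, Finset.sum_mul,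
      smul_mul_assoc]
    rw [Finset.sum_comm]
    simp only [← Finset.smul_sum, hsum]
    simp [smul_smul]
  rw [hc] at h
  simpa [x_ne_zero, card_ne_zero_of_isNondegenerate hα] using h.symm

lemma eq_top_of_forall_exists_conj_x_ne (hα : α.IsNondegenerate) {N : Subgroup S}
    (hN : ∀ t, t ≠ 1 → ∃ n ∈ N, n * t = t * n ∧ conj α n (x α t) ≠ x α t) : N = ⊤ := by
  classical
  have := Fintype.ofFinite S
  have hsum : ∑ s, ((if s ∈ N then (Fintype.card S : k) else 0) - Fintype.card N) •
      conjRep α s = 0 := by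
    rw [← sub_eq_zero.2 (card_smul_sum_conjRep_subgroup hα hN)]
    simp only [sub_smul, Finset.sum_sub_distrib, ite_smul, zero_smul, Finset.smul_sum]
    rw [← Finset.sum_filter, Finset.sum_subtype (p := (· ∈ N)) _ (by simp)]
  have hcoeff := Fintype.linearIndependent_iff.1 (linearIndependent_conjRep hα) _ hsum
  refine (Subgroup.eq_top_iff' N).2 fun s => ?_
  by_contra hs
  have hcard : (Fintype.card N : k) = 0 := by simpa [hs] using hcoeff s
  exact natCast_card_subgroup_ne_zero (card_ne_zero_of_isNondegenerate hα) N hcard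

lemma repr_sum_conj_x_ne_zero (hα : α.IsNondegenerate) {N : Subgroup S} [Fintype N] {t : S}
    (ht : ∀ n ∈ N, n * t = t * n → conj α n (x α t) = x α t) :
    (basis α).repr (∑ n : N, conj α n (x α t)) t ≠ 0 := by
  classical
  have := Fintype.ofFinite S
  let C : Subgroup N := (Subgroup.centralizer {t}).subgroupOf N
  have hterm (n : N) : (basis α).repr (conj α n (x α t)) t = if n ∈ C then 1 else 0 := by
    have hC : n ∈ C ↔ (n : S) * t = t * n := Subgroup.mem_centralizer_singleton_iff
    split_ifs with hn
    · rw [ht n n.2 (hC.1 hn), repr_x, if_pos rfl]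
    · obtain ⟨c, hc⟩ := exists_conj_x α n t
      rw [hc, map_smul, Finsupp.smul_apply, repr_x, if_neg, smul_zero]
      exact fun h => hn (hC.2 (mul_inv_eq_iff_eq_mul.1 h))
  have hsum : (basis α).repr (∑ n : N, conj α n (x α t)) t = (Fintype.card C : k) := by
    simp [map_sum, Finsupp.finsetSum_apply, hterm, Fintype.card_subtype]
  rw [hsum]
  exact natCast_card_subgroup_ne_zero (natCast_card_subgroup_ne_zero
    (card_ne_zero_of_isNondegenerate hα) N) C

end TwistedGroupAlgebra

end TwoCocycle

end TwistedGroupAlgebraConjugation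

section CanonicalMap

variable {k G A : Type*} [Field k] [Group G] [Ring A] [Algebra k A] [MulSemiringAction G A]
  [SMulCommClass G k A]

variable (k A) in
/-- The map `a ⊗ b ↦ a (g.b)`, the component at `g` of the canonical map of the `G`-algebra `A`. -/
def mulSMul (g : G) : A ⊗[k] A →ₗ[k] A :=
  LinearMap.mul' k A ∘ₗ (DistribSMul.toLinearMap k A g).lTensor A

@[simp] lemma mulSMul_tmul (g : G) (a b : A) : mulSMul k A g (a ⊗ₜ b) = a * g • b := rfl

@[simp] lemma sandwich_tmul (x a b : A) : sandwich k x (a ⊗ₜ b) = a * x * b := by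
  simp [sandwich, mul_assoc]

lemma mulSMul_mulLeft (g : G) (a : A) (z : A ⊗[k] A) :
    mulSMul k A g ((LinearMap.mulLeft k a).rTensor A z) = a * mulSMul k A g z := by
  induction z with
  | zero => simp
  | add z w hz hw => simp only [map_add, mul_add, hz, hw]
  | tmul b c => simp [mul_assoc]

variable [Fintype G] [DecidableEq G]

lemma piScalarRight_galoisCoaction (a : A) :
    TensorProduct.piScalarRight k k A G (galoisCoaction k G A a) = fun g => g • a := by
  ext g
  simp [galoisCoaction, Pi.single_apply]

lemma piScalarRight_galoisCan (z : A ⊗[k] A) :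
    TensorProduct.piScalarRight k k A G (galoisCan k G A z) = fun g => mulSMul k A g z := by
  ext g
  induction z with
  | zero => simp
  | add a b ha hb => simp only [map_add, Pi.add_apply, ha, hb]
  | tmul a b =>
    simp [galoisCan, galoisCoaction, TensorProduct.tmul_sum, Pi.single_apply]

lemma galoisCoaction_eq_tmul_one_iff (a : A) :
    galoisCoaction k G A a = a ⊗ₜ (1 : G → k) ↔ ∀ g : G, g • a = a := by
  rw [← (TensorProduct.piScalarRight k k A G).injective.eq_iff, piScalarRight_galoisCoaction]
  simp [funext_iff]

lemma galoisCan_eq_one_tmul_iff (z : A ⊗[k] A) (h : G → k) :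
    galoisCan k G A z = 1 ⊗ₜ h ↔ ∀ g, mulSMul k A g z = h g • 1 := by
  rw [← (TensorProduct.piScalarRight k k A G).injective.eq_iff, piScalarRight_galoisCan]
  simp [funext_iff]

lemma eq_of_forall_mulSMul_eq (hcan : Function.Injective (galoisCan k G A)) {z w : A ⊗[k] A}
    (h : ∀ g : G, mulSMul k A g z = mulSMul k A g w) : z = w :=
  hcan <| (TensorProduct.piScalarRight k k A G).injective <| by
    simpa only [piScalarRight_galoisCan] using funext h

lemma miyashitaUlbrich_eq_sandwich (hcan : Function.Injective (galoisCan k G A)) (a : A)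
    {h : G → k} {z : A ⊗[k] A} (hz : ∀ g, mulSMul k A g z = h g • 1) :
    miyashitaUlbrich k G a h = sandwich k a z := by
  rw [miyashitaUlbrich, ← (galoisCan_eq_one_tmul_iff z h).2 hz, Function.leftInverse_invFun hcan]

lemma galoisCan_surjective {z : G → A ⊗[k] A}
    (hz : ∀ g g', mulSMul k A g' (z g) = if g = g' then 1 else 0) :
    Function.Surjective (galoisCan k G A) := fun w => by
  refine ⟨∑ g, (LinearMap.mulLeft k (TensorProduct.piScalarRight k k A G w g)).rTensor A (z g),
    (TensorProduct.piScalarRight k k A G).injective ?_⟩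
  rw [piScalarRight_galoisCan]
  ext g
  simp [mulSMul_mulLeft, hz]

lemma galoisCan_bijective_of_surjective [FiniteDimensional k A]
    (hA : Module.finrank k A ≤ Fintype.card G) (hcan : Function.Surjective (galoisCan k G A)) :
    Function.Bijective (galoisCan k G A) := by
  refine ⟨LinearMap.ker_eq_bot.1 <| Submodule.finrank_eq_zero.1 ?_, hcan⟩
  have h := (galoisCan k G A).finrank_range_add_finrank_ker
  rw [LinearMap.range_eq_top.2 hcan, finrank_top, Module.finrank_tensorProduct,
    Module.finrank_tensorProduct, Module.finrank_fintype_fun_eq_card] at h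
  have := Nat.mul_le_mul_left (Module.finrank k A) hA
  omega

end CanonicalMap

section GaloisObjectStructure

open TwoCocycle TwoCocycle.TwistedGroupAlgebra

namespace galoisObject

variable {k G : Type*} [Field k] [Group G] {S : Subgroup G} (α : TwoCocycle S k)

variable {α} in
@[ext] lemma ext' {a b : galoisObject α} (h : ∀ u, a.1 u = b.1 u) : a = b :=
  Subtype.ext (funext h)

/-- Evaluation at `u` as a linear map. -/
def eval (u : G) : galoisObject α →ₗ[k] α.TwistedGroupAlgebra :=
  LinearMap.proj u ∘ₗ (galoisObject α).toSubmodule.subtype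

variable {α} in
lemma sum_apply {ι : Type*} (s : Finset ι) (f : ι → galoisObject α) (u : G) :
    (∑ i ∈ s, f i).1 u = ∑ i ∈ s, (f i).1 u :=
  map_sum (eval α u) f s

open Classical in
/-- The function supported on the coset `S r` which takes the value `b` at `r`; such functions
make up the preimages of `1 ⊗ e_g` under the canonical map. -/
def extend (r : G) : α.TwistedGroupAlgebra →ₗ[k] galoisObject α :=
  LinearMap.codRestrict (galoisObject α).toSubmodule
    (LinearMap.pi fun u => if h : u * r⁻¹ ∈ S then conjRep α ⟨u * r⁻¹, h⟩ else 0)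
    fun b s u => by
      have hmem : (s : G) * u * r⁻¹ ∈ S ↔ u * r⁻¹ ∈ S := by
        rw [mul_assoc, S.mul_mem_cancel_left s.2]
      simp only [LinearMap.pi_apply]
      by_cases h : u * r⁻¹ ∈ S
      · rw [dif_pos h, dif_pos (hmem.2 h), conjRep_apply, conjRep_apply, ← conj_mul_left]
        congr 1
        exact Subtype.ext (mul_assoc _ _ _)
      · rw [dif_neg h, dif_neg (mt hmem.1 h)]
        exact (map_zero (conjRep α s)).symm

lemma extend_apply_of_eq {r u : G} (s : S) (h : u = s * r) (b : α.TwistedGroupAlgebra) :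
    (extend α r b).1 u = conj α s b := by
  have hs : u * r⁻¹ = s := by rw [h, mul_inv_cancel_right]
  have hmem : u * r⁻¹ ∈ S := hs ▸ s.2
  have hu : (⟨u * r⁻¹, hmem⟩ : S) = s := Subtype.ext hs
  exact (LinearMap.congr_fun (dif_pos hmem) b).trans (by rw [hu, conjRep_apply])

lemma extend_apply_of_notMem {r u : G} (h : u * r⁻¹ ∉ S) (b : α.TwistedGroupAlgebra) :
    (extend α r b).1 u = 0 :=
  LinearMap.congr_fun (dif_neg h) b

lemma injective_pi_eval_out :
    Function.Injective (LinearMap.pi fun q : G ⧸ S => eval α q.out⁻¹) := fun a b hab =>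
  ext' fun u => by
    obtain ⟨s, hs⟩ := QuotientGroup.mk_out_eq_mul S u⁻¹
    have hout : (s : G)⁻¹ * u = (QuotientGroup.mk u⁻¹ : G ⧸ S).out⁻¹ := by
      rw [hs, mul_inv_rev, inv_inv]
    have heq : a.1 ((s : G)⁻¹ * u) = b.1 ((s : G)⁻¹ * u) := by
      rw [hout]
      exact congrFun hab _
    rw [← mul_inv_cancel_left (s : G) u, a.2, b.2, heq]

instance [Finite G] : FiniteDimensional k (galoisObject α) :=
  have := Module.Finite.of_basis (basis α)
  .of_injective _ (injective_pi_eval_out α)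

lemma finrank_le_card [Finite G] : Module.finrank k (galoisObject α) ≤ Nat.card G := by
  have := Fintype.ofFinite S
  have := Fintype.ofFinite (G ⧸ S)
  have := Module.Finite.of_basis (basis α)
  calc Module.finrank k (galoisObject α)
      ≤ Module.finrank k (G ⧸ S → α.TwistedGroupAlgebra) :=
        LinearMap.finrank_le_finrank_of_injective (injective_pi_eval_out α)
    _ = Nat.card G := by
        rw [Module.finrank_pi_fintype, Finset.sum_const, Finset.card_univ, smul_eq_mul,
          Module.finrank_eq_card_basis (basis α), ← Nat.card_eq_fintype_card,
          ← Nat.card_eq_fintype_card, ← Subgroup.card_eq_card_quotient_mul_card_subgroup]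

variable {α}

lemma exists_eq_smul_one_of_conj_apply_eq [Finite S] (hα : α.IsNondegenerate)
    (a : galoisObject α) (u : G) (h : ∀ s : S, a.1 (s * u) = a.1 u) : ∃ c : k, a.1 u = c • 1 :=
  eq_smul_one_of_conj_eq hα fun s => (a.2 s u).symm.trans (h s)

section CanonicalPreimage

variable [Fintype S]

lemma sum_eq_sum_subgroup [Fintype G] {M : Type*} [AddCommMonoid M] (u : G) (φ : G → M)
    (h : ∀ r, u * r⁻¹ ∉ S → φ r = 0) : ∑ r, φ r = ∑ s : S, φ ((s : G)⁻¹ * u) := by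
  refine (Fintype.sum_of_injective (fun s : S => (s : G)⁻¹ * u) ?_ _ _ ?_ fun _ => rfl).symm
  · intro s t hst
    simpa using hst
  · intro r hr
    refine h r fun hmem => hr ⟨⟨_, hmem⟩, ?_⟩
    simp

variable [DecidableEq G]

lemma sum_extend_mul_extend_of_mem (hα : α.IsNondegenerate) (s : S) (g u u' : G)
    (b : α.TwistedGroupAlgebra) :
    ∑ q, (extend α ((s : G)⁻¹ * u) (x α q)).1 u * b *
        (extend α ((s : G)⁻¹ * u * g) (xInv α q)).1 u' =
      (Fintype.card S : k) •
        ∑ t : S, if u * g * u'⁻¹ = t then (basis α).repr b t • x α t else 0 := by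
  have hleft (c) : (extend α ((s : G)⁻¹ * u) c).1 u = conj α s c :=
    extend_apply_of_eq α s (mul_inv_cancel_left _ _).symm c
  by_cases h : u * g * u'⁻¹ ∈ S
  · have hright (c) : (extend α ((s : G)⁻¹ * u * g) c).1 u' = conj α (⟨u * g * u'⁻¹, h⟩⁻¹ * s) c :=
      extend_apply_of_eq α _ (by simp [mul_assoc]) c
    simp only [hleft, hright, sum_conj_x_mul_mul_conj_xInv hα]
    rw [Finset.sum_eq_single ⟨u * g * u'⁻¹, h⟩]
    · simp [smul_smul]
    · exact fun t _ ht => if_neg fun h' => ht (Subtype.ext h'.symm)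
    · simp
  · have hright (c) : (extend α ((s : G)⁻¹ * u * g) c).1 u' = 0 :=
      extend_apply_of_notMem α (fun h' => h <| by
        simpa [mul_assoc] using S.inv_mem (S.mul_mem h' (S.inv_mem s.2))) c
    have hne (t : S) : u * g * u'⁻¹ ≠ t := fun h' => h (h' ▸ t.2)
    simp [hright, hne]

variable [Fintype G]

lemma sum_sum_extend_mul_extend (hα : α.IsNondegenerate) (g u u' : G)
    (b : α.TwistedGroupAlgebra) :
    ∑ r, ∑ q, (extend α r (x α q)).1 u * b * (extend α (r * g) (xInv α q)).1 u' =
      (Fintype.card S : k) ^ 2 •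
        ∑ t : S, if u * g * u'⁻¹ = t then (basis α).repr b t • x α t else 0 := by
  rw [sum_eq_sum_subgroup (S := S) u _ fun r hr => Finset.sum_eq_zero fun q _ => by
    rw [extend_apply_of_notMem α hr, zero_mul, zero_mul]]
  simp only [sum_extend_mul_extend_of_mem hα, Finset.sum_const, Finset.card_univ,
    ← Nat.cast_smul_eq_nsmul k, smul_smul, pow_two]

variable (α) in
/-- The preimage `|S|⁻² ∑ extend r x_q ⊗ extend (r g) x_q⁻¹` of `1 ⊗ e_g` under the canonical
map. -/
def canPreimage (g : G) : galoisObject α ⊗[k] galoisObject α :=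
  ((Fintype.card S : k) ^ 2)⁻¹ • ∑ r, ∑ q, extend α r (x α q) ⊗ₜ[k] extend α (r * g) (xInv α q)

lemma mulSMul_canPreimage (hα : α.IsNondegenerate) (g g' : G) :
    mulSMul k (galoisObject α) g' (canPreimage α g) = if g = g' then 1 else 0 := by
  ext u
  have key := sum_sum_extend_mul_extend hα g u (u * g') 1
  simp only [mul_one] at key
  have hsum : eval α u (mulSMul k (galoisObject α) g' (canPreimage α g)) =
      ((Fintype.card S : k) ^ 2)⁻¹ •
        ∑ r, ∑ q, (extend α r (x α q)).1 u * (extend α (r * g) (xInv α q)).1 (u * g') := by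
    simp only [canPreimage, map_smul, map_sum, mulSMul_tmul]
    rfl
  have hgg' : u * g * (u * g')⁻¹ = 1 ↔ g = g' := by rw [mul_inv_eq_one, mul_right_inj]
  change eval α u _ = _
  rw [hsum, key, inv_smul_smul₀ (pow_ne_zero 2 (card_ne_zero_of_isNondegenerate hα)),
    Finset.sum_eq_single 1 (fun t _ ht => by simp [repr_one_smul_x, ht]) (by simp)]
  simp only [repr_one_smul_x, Subgroup.coe_one, hgg', if_true]
  split_ifs <;> rfl

lemma sandwich_canPreimage_apply (hα : α.IsNondegenerate) (g u : G) (a : galoisObject α) :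
    (sandwich k a (canPreimage α g)).1 u =
      ∑ t : S, if u * g * u⁻¹ = t then (basis α).repr (a.1 u) t • x α t else 0 := by
  have hsum : (sandwich k a (canPreimage α g)).1 u = ((Fintype.card S : k) ^ 2)⁻¹ •
      ∑ r, ∑ q, (extend α r (x α q)).1 u * a.1 u * (extend α (r * g) (xInv α q)).1 u := by
    change eval α u _ = _
    simp only [canPreimage, map_smul, map_sum, sandwich_tmul]
    rfl
  rw [hsum, sum_sum_extend_mul_extend hα, inv_smul_smul₀]
  exact pow_ne_zero 2 (card_ne_zero_of_isNondegenerate hα)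

end CanonicalPreimage

variable [Fintype G] [DecidableEq G]

lemma galoisCan_bijective (hα : α.IsNondegenerate) :
    Function.Bijective (galoisCan k G (galoisObject α)) :=
  have := Fintype.ofFinite S
  galoisCan_bijective_of_surjective (by simpa using finrank_le_card α)
    (galoisCan_surjective (mulSMul_canPreimage hα))

lemma isGaloisObject (hα : α.IsNondegenerate) : IsGaloisObject k G (galoisObject α) where
  nontrivial := inferInstance
  coinvariants a := by
    rw [galoisCoaction_eq_tmul_one_iff, Algebra.mem_bot]
    constructor
    · intro h
      have hconst (u : G) : a.1 u = a.1 1 := by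
        simpa [galoisObject_smul_apply] using congrArg (fun b => b.1 1) (h u)
      obtain ⟨c, hc⟩ := exists_eq_smul_one_of_conj_apply_eq hα a 1 fun s => hconst _
      refine ⟨c, ext' fun u => ?_⟩
      rw [hconst, hc]
      exact Algebra.algebraMap_eq_smul_one c
    · rintro ⟨c, rfl⟩ g
      rfl
  can_bijective := galoisCan_bijective hα

lemma miyashitaUlbrich_apply [Fintype S] (hα : α.IsNondegenerate) (a : galoisObject α)
    (h : G → k) (u : G) :
    (miyashitaUlbrich k G a h).1 u =
      ∑ s : S, h (u⁻¹ * s * u) • (basis α).repr (a.1 u) s • x α s := by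
  have hz (g : G) : mulSMul k (galoisObject α) g (∑ g', h g' • canPreimage α g') = h g • 1 := by
    simp [mulSMul_canPreimage hα]
  rw [miyashitaUlbrich_eq_sandwich (galoisCan_bijective hα).injective a hz]
  change eval α u _ = _
  simp only [map_sum, map_smul]
  change ∑ g, h g • (sandwich k a (canPreimage α g)).1 u = _
  simp only [sandwich_canPreimage_apply hα, Finset.smul_sum, smul_ite, smul_zero]
  rw [Finset.sum_comm]
  refine Finset.sum_congr rfl fun s _ => ?_
  have hg (g : G) : u * g * u⁻¹ = s ↔ g = u⁻¹ * s * u := by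
    rw [mul_inv_eq_iff_eq_mul, ← eq_inv_mul_iff_mul_eq, mul_assoc]
  simp [hg]

end galoisObject

end GaloisObjectStructure

section FixedSubspace

open TwoCocycle TwoCocycle.TwistedGroupAlgebra

variable {k G : Type*} [Field k] [Group G] {S : Subgroup G} {α : TwoCocycle S k}

lemma eq_or_eq_top_of_le_of_index_prime {F K : Subgroup G} (hF : F.index.Prime) (h : F ≤ K) :
    K = F ∨ K = ⊤ := by
  have hmul := Subgroup.relIndex_mul_index h
  rcases (Nat.dvd_prime hF).1 (Subgroup.index_dvd_of_le h) with h1 | hindex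
  · exact .inr (Subgroup.index_eq_one.1 h1)
  · rw [hindex, Nat.mul_eq_right hF.ne_zero] at hmul
    exact .inl (le_antisymm (Subgroup.relIndex_eq_one.1 hmul) h)

lemma centralizer_eq_of_center_eq_bot (hZ : Subgroup.center G = ⊥) {F : Subgroup G}
    (hF : F.index.Prime) {t : G} (ht : t ≠ 1) (h : F ≤ Subgroup.centralizer {t}) :
    Subgroup.centralizer {t} = F := by
  refine (eq_or_eq_top_of_le_of_index_prime hF h).resolve_right fun htop => ht ?_
  rw [← Subgroup.mem_bot, ← hZ, Subgroup.mem_center_iff]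
  exact fun g => Subgroup.mem_centralizer_singleton_iff.1 (htop ▸ Subgroup.mem_top g)

namespace galoisObject

lemma apply_mul_of_mem_fixedSubspace {F : Subgroup G} {a : galoisObject α}
    (ha : a ∈ fixedSubspace k (galoisObject α) F) (u : G) {g : G} (hg : g ∈ F) :
    a.1 (u * g) = a.1 u := by
  rw [← galoisObject_smul_apply, ha g hg]

lemma exists_apply_eq_smul_one_of_mem_fixedSubspace [Finite S] (hα : α.IsNondegenerate)
    {F : Subgroup G} [hF : F.Normal] (h : S ≤ F) {a : galoisObject α}
    (ha : a ∈ fixedSubspace k (galoisObject α) F) (u : G) : ∃ c : k, a.1 u = c • 1 := by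
  refine exists_eq_smul_one_of_conj_apply_eq hα a u fun s => ?_
  have hmem : u⁻¹ * s * u ∈ F := by simpa using hF.conj_mem s (h s.2) u⁻¹
  rw [← apply_mul_of_mem_fixedSubspace ha u hmem]
  simp only [mul_assoc, mul_inv_cancel_left]

lemma sum_smul_mem_fixedSubspace (F : Subgroup G) [Fintype F] (a : galoisObject α) :
    ∑ m : F, (m : G) • a ∈ fixedSubspace k (galoisObject α) F := fun g hg => by
  simp only [Finset.smul_sum, ← mul_smul]
  exact Equiv.sum_comp (Equiv.mulLeft (⟨g, hg⟩ : F)) fun m => (m : G) • a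

lemma sum_smul_extend_one_apply_one (F : Subgroup G) [Fintype F] [Fintype (F.subgroupOf S)]
    (b : α.TwistedGroupAlgebra) :
    (∑ m : F, (m : G) • extend α 1 b).1 1 = ∑ n : F.subgroupOf S, conj α (n : S) b := by
  simp only [sum_apply, galoisObject_smul_apply, one_mul]
  refine (Fintype.sum_of_injective (fun n : F.subgroupOf S => (⟨(n : S), n.2⟩ : F)) ?_ _ _ ?_
    fun n => ?_).symm
  · exact fun m n hmn => Subtype.ext (Subtype.ext (congrArg (fun g : F => (g : G)) hmn))
  · refine fun m hm => extend_apply_of_notMem α (fun hmS => hm ?_) b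
    rw [inv_one, mul_one] at hmS
    exact ⟨⟨⟨m, hmS⟩, m.2⟩, rfl⟩
  · exact (extend_apply_of_eq α (n : S) (mul_one _).symm b).symm

variable [Fintype G] [DecidableEq G]

lemma isMiyashitaUlbrichStable_of_le (hα : α.IsNondegenerate) {F : Subgroup G} [F.Normal]
    (h : S ≤ F) : IsMiyashitaUlbrichStable G (fixedSubspace k (galoisObject α) F) := by
  have := Fintype.ofFinite S
  intro a ha f
  suffices hf : miyashitaUlbrich k G a f = f 1 • a by
    rw [hf]
    exact Submodule.smul_mem _ _ ha
  ext u
  obtain ⟨c, hc⟩ := exists_apply_eq_smul_one_of_mem_fixedSubspace hα h ha u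
  rw [miyashitaUlbrich_apply hα, Finset.sum_eq_single 1]
  · rw [hc, map_smul, Finsupp.smul_apply, smul_assoc, repr_one_smul_x, if_pos rfl,
      Subgroup.coe_one, mul_one, inv_mul_cancel, ← hc]
    rfl
  · intro s _ hs
    rw [hc, map_smul, Finsupp.smul_apply, smul_assoc, repr_one_smul_x, if_neg hs, smul_zero,
      smul_zero]
  · simp

lemma repr_miyashitaUlbrich_apply (hα : α.IsNondegenerate) (a : galoisObject α) (h : G → k)
    (u : G) (t : S) :
    (basis α).repr ((miyashitaUlbrich k G a h).1 u) t =
      h (u⁻¹ * t * u) * (basis α).repr (a.1 u) t := by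
  have := Fintype.ofFinite S
  rw [miyashitaUlbrich_apply hα, map_sum, Finsupp.finsetSum_apply, Finset.sum_eq_single t]
  · simp
  · intro s _ hs
    simp [hs]
  · simp

/-- Acting by the indicator function of `t` multiplies the `x_t`-coordinate at `u` by `1` if
`u⁻¹tu = t` and by `0` otherwise; on `F`-fixed functions both values must agree. -/
lemma le_centralizer_of_isMiyashitaUlbrichStable (hα : α.IsNondegenerate)
    {F : Subgroup G} (h : IsMiyashitaUlbrichStable G (fixedSubspace k (galoisObject α) F))
    {a : galoisObject α} (ha : a ∈ fixedSubspace k (galoisObject α) F) {t : S}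
    (hat : (basis α).repr (a.1 1) t ≠ 0) : F ≤ Subgroup.centralizer {(t : G)} := by
  intro m hm
  have hfix {b : galoisObject α} (hb : b ∈ fixedSubspace k (galoisObject α) F) :
      b.1 m = b.1 1 := by
    rw [← apply_mul_of_mem_fixedSubspace hb 1 hm, one_mul]
  have heq := congrArg (fun b => (basis α).repr b t) (hfix (h a ha (Pi.single (t : G) 1)))
  simp only [repr_miyashitaUlbrich_apply hα, hfix ha, mul_left_inj' hat, Pi.single_apply] at heq
  have hconj : m⁻¹ * t * m = t := by simpa using heq
  rw [Subgroup.mem_centralizer_singleton_iff, eq_comm, ← inv_mul_eq_iff_eq_mul, ← mul_assoc, hconj]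

lemma le_of_isMiyashitaUlbrichStable (hα : α.IsNondegenerate) (hZ : Subgroup.center G = ⊥)
    {F : Subgroup G} (hF : F.index.Prime)
    (h : IsMiyashitaUlbrichStable G (fixedSubspace k (galoisObject α) F)) : S ≤ F := by
  classical
  rw [← Subgroup.subgroupOf_eq_top]
  refine eq_top_of_forall_exists_conj_x_ne hα fun t ht => ?_
  by_contra! hfix
  have hrepr := repr_sum_conj_x_ne_zero hα hfix
  rw [← sum_smul_extend_one_apply_one] at hrepr
  have hle := le_centralizer_of_isMiyashitaUlbrichStable hα h
    (sum_smul_mem_fixedSubspace F _) hrepr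
  have hcent := centralizer_eq_of_center_eq_bot hZ hF (by simpa using ht) hle
  obtain ⟨s, hst, hne⟩ := exists_conj_x_ne hα ht
  refine hne (hfix s ?_ hst)
  rw [Subgroup.mem_subgroupOf, ← hcent, Subgroup.mem_centralizer_singleton_iff]
  exact congrArg Subtype.val hst

end galoisObject

end FixedSubspace

section DualHopfAlgebra

open Module

variable {k K : Type*} [Field k] [Ring K] [HopfAlgebra k K]

lemma dualMul_eq_convMul (f g : Dual k K) :
    dualMul k K f g = (WithConv.toConv f * WithConv.toConv g).ofConv := by
  have h : TensorProduct.dualDistrib k K K (f ⊗ₜ g) =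
      LinearMap.mul' k k ∘ₗ TensorProduct.map f g := TensorProduct.ext' fun _ _ => rfl
  exact congrArg (· ∘ₗ Coalgebra.comul) h

lemma dualMul_assoc (f g h : Dual k K) :
    dualMul k K (dualMul k K f g) h = dualMul k K f (dualMul k K g h) := by
  simp only [dualMul_eq_convMul, WithConv.toConv_ofConv, mul_assoc]

lemma dualMul_counit (f : Dual k K) : dualMul k K f Coalgebra.counit = f := by
  rw [dualMul_eq_convMul]
  exact congrArg WithConv.ofConv (mul_one (WithConv.toConv f))

lemma lift_dualMul_compl₂_dualAntipode :
    TensorProduct.lift ((dualMul k K).compl₂ (dualAntipode k K)) =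
      ((HopfAlgebra.antipode k).lTensor K ∘ₗ Coalgebra.comul).dualMap ∘ₗ
        TensorProduct.dualDistrib k K K := by
  refine TensorProduct.ext' fun f g => ?_
  have h : TensorProduct.dualDistrib k K K (f ⊗ₜ dualAntipode k K g) =
      TensorProduct.dualDistrib k K K (f ⊗ₜ g) ∘ₗ (HopfAlgebra.antipode k).lTensor K :=
    TensorProduct.ext' fun _ _ => rfl
  exact congrArg (· ∘ₗ Coalgebra.comul) h

lemma lift_dualMul_comp_dualAntipode :
    TensorProduct.lift (dualMul k K ∘ₗ dualAntipode k K) =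
      ((HopfAlgebra.antipode k).rTensor K ∘ₗ Coalgebra.comul).dualMap ∘ₗ
        TensorProduct.dualDistrib k K K := by
  refine TensorProduct.ext' fun f g => ?_
  have h : TensorProduct.dualDistrib k K K (dualAntipode k K f ⊗ₜ g) =
      TensorProduct.dualDistrib k K K (f ⊗ₜ g) ∘ₗ (HopfAlgebra.antipode k).rTensor K :=
    TensorProduct.ext' fun _ _ => rfl
  exact congrArg (· ∘ₗ Coalgebra.comul) h

variable (k K) in
/-- The right coadjoint coaction `y ↦ y₂ ⊗ S(y₁) y₃` of `K` on itself, dual to the right adjoint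
action of `K*`. -/
def coadjoint : K →ₗ[k] K ⊗[k] K :=
  (LinearMap.mul' k K ∘ₗ (HopfAlgebra.antipode k).rTensor K).lTensor K ∘ₗ
    (TensorProduct.leftComm k K K K).toLinearMap ∘ₗ Coalgebra.comul.lTensor K ∘ₗ Coalgebra.comul

lemma lift_dualMul_flip_comp_dualAntipode (g : Dual k K) (t : Dual k K ⊗[k] Dual k K) :
    TensorProduct.lift (dualMul k K ∘ₗ (dualMul k K).flip g ∘ₗ dualAntipode k K) t =
      TensorProduct.dualDistrib k K (K ⊗[k] K)
        (g ⊗ₜ (TensorProduct.dualDistrib k K K t ∘ₗ (HopfAlgebra.antipode k).rTensor K)) ∘ₗ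
        (TensorProduct.leftComm k K K K).toLinearMap ∘ₗ
        Coalgebra.comul.lTensor K ∘ₗ Coalgebra.comul := by
  induction t with
  | zero => simp
  | add a b ha hb => simp only [map_add, ha, hb, LinearMap.add_comp, TensorProduct.tmul_add]
  | tmul a b =>
    have h : TensorProduct.dualDistrib k K K (dualAntipode k K a ⊗ₜ dualMul k K g b) =
        TensorProduct.dualDistrib k K (K ⊗[k] K)
          (g ⊗ₜ (TensorProduct.dualDistrib k K K (a ⊗ₜ b) ∘ₗ
            (HopfAlgebra.antipode k).rTensor K)) ∘ₗ
          (TensorProduct.leftComm k K K K).toLinearMap ∘ₗ Coalgebra.comul.lTensor K := by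
      refine TensorProduct.ext' fun p q => ?_
      change a _ * TensorProduct.dualDistrib k K K (g ⊗ₜ b) (Coalgebra.comul q) =
        TensorProduct.dualDistrib k K (K ⊗[k] K) _
          (TensorProduct.leftComm k K K K (p ⊗ₜ Coalgebra.comul q))
      induction Coalgebra.comul (R := k) q with
      | zero => simp
      | add x y hx hy => simp only [TensorProduct.tmul_add, map_add, mul_add, hx, hy]
      | tmul x y => exact mul_left_comm _ _ _
    change dualMul k K (dualMul k K (dualAntipode k K a) g) b = _
    rw [dualMul_assoc]
    exact congrArg (· ∘ₗ Coalgebra.comul) h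

lemma dualDistrib_sum_basis_coord {ι : Type*} [Fintype ι] (b : Basis ι k K)
    (Φ : Dual k (K ⊗[k] K)) :
    Φ = ∑ i, TensorProduct.dualDistrib k K K
      ((Φ ∘ₗ (TensorProduct.mk k K K).flip (b i)) ⊗ₜ b.coord i) := by
  refine TensorProduct.ext' fun p q => ?_
  conv_lhs => rw [← b.sum_repr q, TensorProduct.tmul_sum, map_sum]
  simp [mul_comm]

variable [FiniteDimensional k K]

lemma dualDistrib_dualComul (f : Dual k K) :
    TensorProduct.dualDistrib k K K (dualComul k K f) = f ∘ₗ LinearMap.mul' k K :=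
  (TensorProduct.dualDistribEquiv k K K).apply_symm_apply _

lemma lift_dualMul_compl₂_dualAntipode_dualComul (f : Dual k K) :
    TensorProduct.lift ((dualMul k K).compl₂ (dualAntipode k K)) (dualComul k K f) =
      f 1 • Coalgebra.counit := by
  rw [lift_dualMul_compl₂_dualAntipode, LinearMap.comp_apply, dualDistrib_dualComul]
  ext y
  simp [HopfAlgebra.mul_antipode_lTensor_comul_apply, Algebra.algebraMap_eq_smul_one, mul_comm]

lemma lift_dualMul_comp_dualAntipode_dualComul (f : Dual k K) :
    TensorProduct.lift (dualMul k K ∘ₗ dualAntipode k K) (dualComul k K f) =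
      f 1 • Coalgebra.counit := by
  rw [lift_dualMul_comp_dualAntipode, LinearMap.comp_apply, dualDistrib_dualComul]
  ext y
  simp [HopfAlgebra.mul_antipode_rTensor_comul_apply, Algebra.algebraMap_eq_smul_one, mul_comm]

lemma dualAdjointLeft_of_central {g : Dual k K} (hg : ∀ f, dualMul k K f g = dualMul k K g f)
    (f : Dual k K) : dualAdjointLeft f g = f 1 • g := by
  have h : TensorProduct.lift
      (((dualMul k K).compl₂ (dualAntipode k K)) ∘ₗ (dualMul k K).flip g) =
      dualMul k K g ∘ₗ TensorProduct.lift ((dualMul k K).compl₂ (dualAntipode k K)) := by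
    refine TensorProduct.ext' fun a b => ?_
    simp only [LinearMap.comp_apply, TensorProduct.lift.tmul, LinearMap.compl₂_apply,
      LinearMap.flip_apply, hg a, dualMul_assoc]
  rw [dualAdjointLeft, h, LinearMap.comp_apply, lift_dualMul_compl₂_dualAntipode_dualComul,
    map_smul, dualMul_counit]

lemma dualAdjointRight_of_central {g : Dual k K} (hg : ∀ f, dualMul k K f g = dualMul k K g f)
    (f : Dual k K) : dualAdjointRight f g = f 1 • g := by
  have h : TensorProduct.lift (dualMul k K ∘ₗ (dualMul k K).flip g ∘ₗ dualAntipode k K) =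
      dualMul k K g ∘ₗ TensorProduct.lift (dualMul k K ∘ₗ dualAntipode k K) := by
    refine TensorProduct.ext' fun a b => ?_
    simp only [LinearMap.comp_apply, TensorProduct.lift.tmul, LinearMap.flip_apply, hg,
      dualMul_assoc]
  rw [dualAdjointRight, h, LinearMap.comp_apply, lift_dualMul_comp_dualAntipode_dualComul,
    map_smul, dualMul_counit]

lemma isNormalInDual_of_central {W : Submodule k (Dual k K)}
    (hW : ∀ f, ∀ g ∈ W, dualMul k K f g = dualMul k K g f) : IsNormalInDual W := fun f g hg => by
  rw [dualAdjointLeft_of_central (hW · g hg), dualAdjointRight_of_central (hW · g hg)]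
  exact ⟨W.smul_mem _ hg, W.smul_mem _ hg⟩

lemma dualAdjointRight_eq_comp_coadjoint (f g : Dual k K) :
    dualAdjointRight f g = TensorProduct.dualDistrib k K K (g ⊗ₜ f) ∘ₗ coadjoint k K := by
  have h : TensorProduct.dualDistrib k K (K ⊗[k] K) (g ⊗ₜ ((f ∘ₗ LinearMap.mul' k K) ∘ₗ
      (HopfAlgebra.antipode k).rTensor K)) = TensorProduct.dualDistrib k K K (g ⊗ₜ f) ∘ₗ
      (LinearMap.mul' k K ∘ₗ (HopfAlgebra.antipode k).rTensor K).lTensor K :=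
    TensorProduct.ext' fun _ _ => rfl
  rw [dualAdjointRight, lift_dualMul_flip_comp_dualAntipode, dualDistrib_dualComul, h, coadjoint,
    LinearMap.comp_assoc]

lemma IsNormalInDual.comp_coadjoint_mem {W : Submodule k (Dual k K)} (hW : IsNormalInDual W)
    {Φ : Dual k (K ⊗[k] K)} (hΦ : ∀ w, Φ ∘ₗ (TensorProduct.mk k K K).flip w ∈ W) :
    Φ ∘ₗ coadjoint k K ∈ W := by
  let b := finBasis k K
  have h : Φ ∘ₗ coadjoint k K =
      ∑ i, dualAdjointRight (b.coord i) (Φ ∘ₗ (TensorProduct.mk k K K).flip (b i)) := by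
    conv_lhs => rw [dualDistrib_sum_basis_coord b Φ]
    ext y
    simp only [dualAdjointRight_eq_comp_coadjoint, LinearMap.comp_apply, LinearMap.sum_apply]
  rw [h]
  exact W.sum_mem fun i _ => (hW _ _ (hΦ _)).2

end DualHopfAlgebra

section ModuleAlgebra

variable {k G A K : Type*} [Field k] [Group G] [Ring A] [Algebra k A]
  [MulSemiringAction G A] [Ring K] [HopfAlgebra k K]

/-- The action `a ⊗ b ↦ a.p ⊗ b.q` of `p ⊗ q ∈ K ⊗ K` on `A ⊗ A` induced by `ρ y a = a.y`. -/
def tensorAction (ρ : K →ₗ[k] A →ₗ[k] A) : K ⊗[k] K →ₗ[k] (A ⊗[k] A →ₗ[k] A ⊗[k] A) :=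
  TensorProduct.homTensorHomMap (.id k) A A A A ∘ₗ TensorProduct.map ρ ρ

@[simp] lemma tensorAction_tmul (ρ : K →ₗ[k] A →ₗ[k] A) (p q : K) :
    tensorAction ρ (p ⊗ₜ q) = TensorProduct.map (ρ p) (ρ q) := rfl

variable (k A) in
/-- The pairing `x, a ⊗ b ↦ a x b`, that is, `sandwich` made linear in `x`. -/
def sandwichBilinear : A →ₗ[k] A ⊗[k] A →ₗ[k] A :=
  (LinearMap.rTensorHom A ∘ₗ (LinearMap.mul k A).flip).compr₂ (LinearMap.mul' k A)

lemma sandwichBilinear_eq_sandwich (x : A) : sandwichBilinear k A x = sandwich k x :=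
  TensorProduct.ext' fun a b => by simp [sandwichBilinear]

/-- The map `p ⊗ v ↦ sandwich (x.p) (z.v)`, which expresses the action on `∑ a x b` for
`z = ∑ a ⊗ b` through the iterated comultiplication. -/
def sandwichAction (ρ : K →ₗ[k] A →ₗ[k] A) (x : A) (z : A ⊗[k] A) : K ⊗[k] (K ⊗[k] K) →ₗ[k] A :=
  TensorProduct.lift ((sandwichBilinear k A).compl₁₂ (ρ.flip x) ((tensorAction ρ).flip z))

@[simp] lemma sandwichAction_tmul (ρ : K →ₗ[k] A →ₗ[k] A) (x : A) (z : A ⊗[k] A) (p : K)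
    (v : K ⊗[k] K) : sandwichAction ρ x z (p ⊗ₜ v) = sandwich k (ρ p x) (tensorAction ρ v z) := by
  simp [sandwichAction, sandwichBilinear_eq_sandwich]

lemma lift_mul_antipode_comul_rTensor_comul (y : K) :
    TensorProduct.lift ((LinearMap.mul k (K ⊗[k] K)).compl₂
      (TensorProduct.mk k K K 1 ∘ₗ HopfAlgebra.antipode k))
      (Coalgebra.comul.rTensor K (Coalgebra.comul y)) = y ⊗ₜ 1 := by
  have hassoc : TensorProduct.lift ((LinearMap.mul k (K ⊗[k] K)).compl₂
      (TensorProduct.mk k K K 1 ∘ₗ HopfAlgebra.antipode k)) =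
      (LinearMap.mul' k K ∘ₗ (HopfAlgebra.antipode k).lTensor K).lTensor K ∘ₗ
        (TensorProduct.assoc k K K K).toLinearMap :=
    TensorProduct.ext_threefold fun p q r => by simp
  have hantipode : (LinearMap.mul' k K ∘ₗ (HopfAlgebra.antipode k).lTensor K).lTensor K ∘ₗ
      Coalgebra.comul.lTensor K =
        (Algebra.linearMap k K).lTensor K ∘ₗ Coalgebra.counit.lTensor K := by
    rw [← LinearMap.lTensor_comp, ← LinearMap.lTensor_comp, LinearMap.comp_assoc,
      HopfAlgebra.mul_antipode_lTensor_comul]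
  rw [hassoc, LinearMap.comp_apply, LinearEquiv.coe_coe, Coalgebra.coassoc_apply,
    ← LinearMap.comp_apply, hantipode, LinearMap.comp_apply, Coalgebra.lTensor_counit_comul]
  simp

/-- A right module algebra structure over the Hopf algebra `K` on `A`, `ρ y a = a.y`, commuting
with the action of `G`. -/
structure IsEquivariantModuleAlgebra (G : Type*) [Group G] [MulSemiringAction G A]
    (ρ : K →ₗ[k] A →ₗ[k] A) : Prop where
  mul_apply : ∀ p q a, ρ (p * q) a = ρ q (ρ p a)
  one_apply : ∀ a, ρ 1 a = a
  apply_one : ∀ y, ρ y 1 = Coalgebra.counit (R := k) y • (1 : A)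
  apply_mul : ∀ y a b,
    ρ y (a * b) = LinearMap.mul' k A (tensorAction ρ (Coalgebra.comul y) (a ⊗ₜ b))
  apply_smul : ∀ y (g : G) a, ρ y (g • a) = g • ρ y a

namespace IsEquivariantModuleAlgebra

variable {ρ : K →ₗ[k] A →ₗ[k] A}

lemma tensorAction_mul (hρ : IsEquivariantModuleAlgebra G ρ) (v w : K ⊗[k] K) (z : A ⊗[k] A) :
    tensorAction ρ (v * w) z = tensorAction ρ w (tensorAction ρ v z) := by
  induction v with
  | zero => simp
  | add a b ha hb => simp only [add_mul, map_add, LinearMap.add_apply, ha, hb]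
  | tmul p q =>
    induction w with
    | zero => simp
    | add a b ha hb => simp only [mul_add, map_add, LinearMap.add_apply, ha, hb]
    | tmul r s =>
      induction z with
      | zero => simp
      | add a b ha hb => simp only [map_add, ha, hb]
      | tmul a b => simp [hρ.mul_apply]

lemma apply_sandwich (hρ : IsEquivariantModuleAlgebra G ρ) (x : A) (z : A ⊗[k] A) (y : K) :
    ρ y (sandwich k x z) = sandwichAction ρ x z (TensorProduct.leftComm k K K K
      (Coalgebra.comul.lTensor K (Coalgebra.comul y))) := by
  have hmul (a b : A) (w : K ⊗[k] K) :
      LinearMap.mul' k A (tensorAction ρ w (a ⊗ₜ (x * b))) =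
        sandwichAction ρ x (a ⊗ₜ b) (TensorProduct.leftComm k K K K
          (Coalgebra.comul.lTensor K w)) := by
    induction w with
    | zero => simp
    | add p q hp hq => simp only [map_add, LinearMap.add_apply, hp, hq]
    | tmul p r =>
      rw [tensorAction_tmul, TensorProduct.map_tmul, LinearMap.mul'_apply, hρ.apply_mul,
        LinearMap.lTensor_tmul]
      induction Coalgebra.comul (R := k) r with
      | zero => simp
      | add p q hp hq =>
        simp only [map_add, LinearMap.add_apply, mul_add, TensorProduct.tmul_add, hp, hq]
      | tmul q r => simp [mul_assoc]
  have hz (z w : A ⊗[k] A) : sandwichAction ρ x (z + w) =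
      sandwichAction ρ x z + sandwichAction ρ x w :=
    TensorProduct.ext' fun p v => by simp
  induction z with
  | zero =>
    have h0 : sandwichAction ρ x 0 = 0 := TensorProduct.ext' fun p v => by simp
    simp [h0]
  | add a b ha hb => rw [map_add, map_add, ha, hb, hz, LinearMap.add_apply]
  | tmul a b => rw [sandwich_tmul, mul_assoc, hρ.apply_mul, hmul]

variable [SMulCommClass G k A]

lemma mulSMul_tensorAction_comul (hρ : IsEquivariantModuleAlgebra G ρ) (g : G) (y : K)
    (z : A ⊗[k] A) :
    mulSMul k A g (tensorAction ρ (Coalgebra.comul y) z) = ρ y (mulSMul k A g z) := by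
  induction z with
  | zero => simp
  | add a b ha hb => simp only [map_add, ha, hb]
  | tmul a b =>
    rw [mulSMul_tmul, hρ.apply_mul]
    induction Coalgebra.comul (R := k) y with
    | zero => simp
    | add p q hp hq => simp only [map_add, LinearMap.add_apply, hp, hq]
    | tmul p q => simp [hρ.apply_smul]

variable [Fintype G] [DecidableEq G] {h : G → k} {T : A ⊗[k] A}

lemma tensorAction_comul_apply (hρ : IsEquivariantModuleAlgebra G ρ)
    (hcan : Function.Injective (galoisCan k G A)) (hT : ∀ g, mulSMul k A g T = h g • 1) (y : K) :
    tensorAction ρ (Coalgebra.comul y) T = Coalgebra.counit (R := k) y • T :=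
  eq_of_forall_mulSMul_eq hcan fun g => by
    rw [hρ.mulSMul_tensorAction_comul, map_smul, hT, map_smul, hρ.apply_one, smul_comm]

lemma tensorAction_tmul_one (hρ : IsEquivariantModuleAlgebra G ρ)
    (hcan : Function.Injective (galoisCan k G A)) (hT : ∀ g, mulSMul k A g T = h g • 1) (y : K) :
    tensorAction ρ (y ⊗ₜ 1) T = tensorAction ρ (1 ⊗ₜ HopfAlgebra.antipode k y) T := by
  have hcomul : (tensorAction ρ).flip T ∘ₗ TensorProduct.lift ((LinearMap.mul k (K ⊗[k] K)).compl₂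
      (TensorProduct.mk k K K 1 ∘ₗ HopfAlgebra.antipode k)) ∘ₗ Coalgebra.comul.rTensor K =
      (tensorAction ρ).flip T ∘ₗ TensorProduct.mk k K K 1 ∘ₗ HopfAlgebra.antipode k ∘ₗ
        (TensorProduct.lid k K).toLinearMap ∘ₗ Coalgebra.counit.rTensor K :=
    TensorProduct.ext' fun p q => by
      simp [hρ.tensorAction_mul, hρ.tensorAction_comul_apply hcan hT]
  have h := LinearMap.congr_fun hcomul (Coalgebra.comul y)
  simp only [LinearMap.comp_apply, lift_mul_antipode_comul_rTensor_comul,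
    Coalgebra.rTensor_counit_comul] at h
  simpa using h

lemma apply_sandwich_eq_coadjoint (hρ : IsEquivariantModuleAlgebra G ρ)
    (hcan : Function.Injective (galoisCan k G A)) (hT : ∀ g, mulSMul k A g T = h g • 1)
    (x : A) (y : K) :
    ρ y (sandwich k x T) =
      sandwichAction ρ x T ((TensorProduct.mk k K K 1).lTensor K (coadjoint k K y)) := by
  have h : sandwichAction ρ x T = sandwichAction ρ x T ∘ₗ (TensorProduct.mk k K K 1).lTensor K ∘ₗ
      (LinearMap.mul' k K ∘ₗ (HopfAlgebra.antipode k).rTensor K).lTensor K := by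
    refine TensorProduct.ext_threefold' fun q p r => ?_
    have hpr : p ⊗ₜ[k] r = (p ⊗ₜ[k] (1 : K)) * ((1 : K) ⊗ₜ[k] r) := by simp
    have hSpr : (1 : K) ⊗ₜ[k] (HopfAlgebra.antipode k p * r) =
        ((1 : K) ⊗ₜ[k] HopfAlgebra.antipode k p) * ((1 : K) ⊗ₜ[k] r) := by simp
    simp only [LinearMap.comp_apply, LinearMap.lTensor_tmul, LinearMap.rTensor_tmul,
      LinearMap.mul'_apply, TensorProduct.mk_apply, sandwichAction_tmul]
    rw [hpr, hSpr, hρ.tensorAction_mul, hρ.tensorAction_mul, hρ.tensorAction_tmul_one hcan hT]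
  rw [hρ.apply_sandwich]
  exact LinearMap.congr_fun h _

lemma comp_flip_sandwich_mem [FiniteDimensional k K] (hρ : IsEquivariantModuleAlgebra G ρ)
    (hcan : Function.Injective (galoisCan k G A)) (hT : ∀ g, mulSMul k A g T = h g • 1)
    {W : Submodule k (Module.Dual k K)} (hW : IsNormalInDual W) {x : A}
    (hx : ∀ ℓ : Module.Dual k A, ℓ ∘ₗ ρ.flip x ∈ W) (ℓ : Module.Dual k A) :
    ℓ ∘ₗ ρ.flip (sandwich k x T) ∈ W := by
  have hcoadjoint : ℓ ∘ₗ ρ.flip (sandwich k x T) =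
      (ℓ ∘ₗ sandwichAction ρ x T ∘ₗ (TensorProduct.mk k K K 1).lTensor K) ∘ₗ coadjoint k K :=
    LinearMap.ext fun y => congrArg ℓ (hρ.apply_sandwich_eq_coadjoint hcan hT x y)
  rw [hcoadjoint]
  refine hW.comp_coadjoint_mem fun w => ?_
  have hw : (ℓ ∘ₗ sandwichAction ρ x T ∘ₗ (TensorProduct.mk k K K 1).lTensor K) ∘ₗ
      (TensorProduct.mk k K K).flip w =
      (ℓ ∘ₗ (sandwichBilinear k A).flip (tensorAction ρ (1 ⊗ₜ w) T)) ∘ₗ ρ.flip x := by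
    ext q
    simp [sandwichBilinear_eq_sandwich]
  rw [hw]
  exact hx _

end IsEquivariantModuleAlgebra

end ModuleAlgebra

section GroupAlgebraTwist

open Module

variable {k G : Type*} [Field k] [Group G]

lemma subgroupTensor_mono {S F : Subgroup G} (h : S ≤ F) :
    subgroupTensor k S ≤ subgroupTensor k F := by
  rintro _ ⟨j, rfl⟩
  have hι : MonoidAlgebra.mapDomainAlgHom k k S.subtype =
      (MonoidAlgebra.mapDomainAlgHom k k F.subtype).comp
        (MonoidAlgebra.mapDomainAlgHom k k (Subgroup.inclusion h)) :=
    MonoidAlgebra.mapDomainAlgHom_comp (Subgroup.inclusion h) F.subtype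
  rw [hι, Algebra.TensorProduct.map_comp]
  exact ⟨_, rfl⟩

namespace HopfTwist

variable (J : HopfTwist k (MonoidAlgebra k G)) (F : Subgroup G) [F.Normal]

/-- The algebra projection `kG → k(G/F)`, which underlies `twistedQuotient J F`. -/
def quotientProj : MonoidAlgebra k G →ₐ[k] MonoidAlgebra k (G ⧸ F) :=
  MonoidAlgebra.mapDomainAlgHom k k (QuotientGroup.mk' F)

@[simp] lemma quotientProj_single (u : G) (c : k) :
    quotientProj F (MonoidAlgebra.single u c) = MonoidAlgebra.single (u : G ⧸ F) c :=
  MonoidAlgebra.mapDomain_single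

lemma quotientProj_surjective : Function.Surjective (quotientProj (k := k) F) := fun x => by
  induction x using MonoidAlgebra.induction_linear with
  | zero => exact ⟨0, map_zero _⟩
  | add a b ha hb =>
    obtain ⟨a, rfl⟩ := ha
    obtain ⟨b, rfl⟩ := hb
    exact ⟨a + b, map_add _ _ _⟩
  | single q c =>
    obtain ⟨u, rfl⟩ := QuotientGroup.mk_surjective q
    exact ⟨MonoidAlgebra.single u c, quotientProj_single F u c⟩

/-- The Hopf subalgebra of `((kG)^J)*` dual to the quotient `(kG)^J → k(G/F)^{J̄}`: the functionals
which factor through `k(G/F)`. -/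
def quotientDual : Submodule k (Dual k J.Twisted) :=
  LinearMap.range ((twistedQuotient J F : J.Twisted →ₐ[k]
    (J.map (MonoidAlgebra.mapDomainBialgHom k (QuotientGroup.mk' F))).Twisted).toLinearMap.dualMap)

variable {J F}

lemma mem_quotientDual_iff_exists {φ : Dual k (MonoidAlgebra k G)} :
    (show Dual k J.Twisted from φ) ∈ quotientDual J F ↔
      ∃ ψ : Dual k (MonoidAlgebra k (G ⧸ F)), ψ ∘ₗ (quotientProj F).toLinearMap = φ :=
  Iff.rfl

lemma mem_quotientDual_iff {φ : Dual k (MonoidAlgebra k G)} :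
    (show Dual k J.Twisted from φ) ∈ quotientDual J F ↔
      ∀ n ∈ F, ∀ x, φ (x * MonoidAlgebra.single n 1) = φ x := by
  rw [mem_quotientDual_iff_exists]
  constructor
  · rintro ⟨ψ, rfl⟩ n hn x
    simp [(QuotientGroup.eq_one_iff n).2 hn, ← MonoidAlgebra.one_def]
  · intro h
    let ψ : Dual k (MonoidAlgebra k (G ⧸ F)) :=
      (Finsupp.lift k k (G ⧸ F) fun q => φ (MonoidAlgebra.single q.out 1)) ∘ₗ
        (MonoidAlgebra.coeffLinearEquiv k).toLinearMap
    refine ⟨ψ, MonoidAlgebra.lhom_ext' fun u => LinearMap.ext_ring ?_⟩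
    have hu : u⁻¹ * (u : G ⧸ F).out ∈ F := QuotientGroup.eq.1 (QuotientGroup.out_eq' _).symm
    simpa [ψ] using h _ hu (MonoidAlgebra.single u 1)

lemma quotientProj_comp_mapDomainAlgHom_subtype :
    (quotientProj F).comp (MonoidAlgebra.mapDomainAlgHom k k F.subtype) =
      ((Algebra.ofId k (MonoidAlgebra k (G ⧸ F))).comp
        (Bialgebra.counitAlgHom k (MonoidAlgebra k G))).comp
        (MonoidAlgebra.mapDomainAlgHom k k F.subtype) := by
  refine MonoidAlgebra.algHom_ext (fun n => ?_) (AlgHom.ext fun _ => by simp)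
  simp [(QuotientGroup.eq_one_iff (n : G)).2 n.2, ← MonoidAlgebra.one_def]

lemma map_id_quotientProj_val
    (hJ : (J.val : MonoidAlgebra k G ⊗[k] MonoidAlgebra k G) ∈ subgroupTensor k F) :
    Algebra.TensorProduct.map (AlgHom.id k (MonoidAlgebra k G)) (quotientProj F)
      (J.val : MonoidAlgebra k G ⊗[k] MonoidAlgebra k G) = 1 := by
  have hcounit : Algebra.TensorProduct.map (AlgHom.id k (MonoidAlgebra k G))
      (Bialgebra.counitAlgHom k (MonoidAlgebra k G))
      (J.val : MonoidAlgebra k G ⊗[k] MonoidAlgebra k G) = 1 :=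
    (Algebra.TensorProduct.rid k k _).injective (J.counit_right.trans (map_one _).symm)
  have hproj : (Algebra.TensorProduct.map (.id k (MonoidAlgebra k G)) (quotientProj F)).comp
      (Algebra.TensorProduct.map (MonoidAlgebra.mapDomainAlgHom k k F.subtype)
        (MonoidAlgebra.mapDomainAlgHom k k F.subtype)) =
      ((Algebra.TensorProduct.map (.id k _) (Algebra.ofId k _)).comp
        (Algebra.TensorProduct.map (.id k (MonoidAlgebra k G)) (Bialgebra.counitAlgHom k _))).comp
        (Algebra.TensorProduct.map (MonoidAlgebra.mapDomainAlgHom k k F.subtype)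
          (MonoidAlgebra.mapDomainAlgHom k k F.subtype)) := by
    simp only [← Algebra.TensorProduct.map_comp, AlgHom.comp_id,
      quotientProj_comp_mapDomainAlgHom_subtype]
  obtain ⟨j, hj : Algebra.TensorProduct.map _ _ j = _⟩ := hJ
  simpa only [AlgHom.comp_apply, hj, hcounit, map_one] using AlgHom.congr_fun hproj j

lemma map_quotientProj_id_val
    (hJ : (J.val : MonoidAlgebra k G ⊗[k] MonoidAlgebra k G) ∈ subgroupTensor k F) :
    Algebra.TensorProduct.map (quotientProj F) (AlgHom.id k (MonoidAlgebra k G))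
      (J.val : MonoidAlgebra k G ⊗[k] MonoidAlgebra k G) = 1 := by
  have hcounit : Algebra.TensorProduct.map (Bialgebra.counitAlgHom k (MonoidAlgebra k G))
      (AlgHom.id k (MonoidAlgebra k G))
      (J.val : MonoidAlgebra k G ⊗[k] MonoidAlgebra k G) = 1 :=
    (Algebra.TensorProduct.lid k _).injective (J.counit_left.trans (map_one _).symm)
  have hproj : (Algebra.TensorProduct.map (quotientProj F) (.id k (MonoidAlgebra k G))).comp
      (Algebra.TensorProduct.map (MonoidAlgebra.mapDomainAlgHom k k F.subtype)
        (MonoidAlgebra.mapDomainAlgHom k k F.subtype)) =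
      ((Algebra.TensorProduct.map (Algebra.ofId k _) (.id k _)).comp
        (Algebra.TensorProduct.map (Bialgebra.counitAlgHom k _) (.id k (MonoidAlgebra k G)))).comp
        (Algebra.TensorProduct.map (MonoidAlgebra.mapDomainAlgHom k k F.subtype)
          (MonoidAlgebra.mapDomainAlgHom k k F.subtype)) := by
    simp only [← Algebra.TensorProduct.map_comp, AlgHom.comp_id,
      quotientProj_comp_mapDomainAlgHom_subtype]
  obtain ⟨j, hj : Algebra.TensorProduct.map _ _ j = _⟩ := hJ
  simpa only [AlgHom.comp_apply, hj, hcounit, map_one] using AlgHom.congr_fun hproj j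

lemma algHom_twistedComul_of_val_eq_one {H B : Type*} [Ring H] [HopfAlgebra k H] [Ring B]
    [Algebra k B] (J : HopfTwist k H) {Ψ : H ⊗[k] H →ₐ[k] B} (hΨ : Ψ J.val = 1) (y : H) :
    Ψ (J.twistedComul y) = Ψ (Coalgebra.comul y) := by
  have hΨinv : Ψ ((J.val⁻¹ : (H ⊗[k] H)ˣ) : H ⊗[k] H) = 1 := by
    have h := congrArg Ψ J.val.mul_inv
    rwa [map_mul, hΨ, one_mul, map_one] at h
  rw [twistedComul_apply, map_mul, map_mul, hΨ, hΨinv, one_mul, mul_one]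
  rfl

lemma dualMul_comm_of_mem_quotientDual
    (hJ : (J.val : MonoidAlgebra k G ⊗[k] MonoidAlgebra k G) ∈ subgroupTensor k F)
    (f : Dual k J.Twisted) {g : Dual k J.Twisted} (hg : g ∈ quotientDual J F) :
    dualMul k J.Twisted f g = dualMul k J.Twisted g f := by
  obtain ⟨ψ, rfl⟩ := mem_quotientDual_iff_exists.1 hg
  let f' : Dual k (MonoidAlgebra k G) := f
  let ψ' : Dual k (MonoidAlgebra k G) := ψ ∘ₗ (quotientProj F).toLinearMap
  have hright : TensorProduct.dualDistrib k _ _ (f' ⊗ₜ[k] ψ') =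
      TensorProduct.dualDistrib k _ _ (f' ⊗ₜ[k] ψ) ∘ₗ (Algebra.TensorProduct.map
        (AlgHom.id k (MonoidAlgebra k G)) (quotientProj F)).toLinearMap :=
    TensorProduct.ext' fun _ _ => rfl
  have hleft : TensorProduct.dualDistrib k _ _ (ψ' ⊗ₜ[k] f') =
      TensorProduct.dualDistrib k _ _ (ψ ⊗ₜ[k] f') ∘ₗ (Algebra.TensorProduct.map
        (quotientProj F) (AlgHom.id k (MonoidAlgebra k G))).toLinearMap :=
    TensorProduct.ext' fun _ _ => rfl
  have hcomm : TensorProduct.dualDistrib k _ _ (f' ⊗ₜ[k] ψ') ∘ₗ J.twistedComul.toLinearMap =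
      TensorProduct.dualDistrib k _ _ (ψ' ⊗ₜ[k] f') ∘ₗ J.twistedComul.toLinearMap := by
    refine MonoidAlgebra.lhom_ext' fun u => LinearMap.ext_ring ?_
    simp only [LinearMap.comp_apply, AlgHom.toLinearMap_apply, hright, hleft,
      algHom_twistedComul_of_val_eq_one J (map_id_quotientProj_val hJ),
      algHom_twistedComul_of_val_eq_one J (map_quotientProj_id_val hJ)]
    simp [mul_comm]
  exact hcomm

lemma isConormal_of_mem_subgroupTensor [Finite G]
    (hJ : (J.val : MonoidAlgebra k G ⊗[k] MonoidAlgebra k G) ∈ subgroupTensor k F) :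
    IsConormal (twistedQuotient J F) :=
  ⟨quotientProj_surjective F, isNormalInDual_of_central fun f _ hg =>
    dualMul_comm_of_mem_quotientDual hJ f hg⟩

end HopfTwist

section CrossedProduct

variable {A : Type*} [Ring A] [Algebra k A] (e : A ≃ₗ[k] Dual k (MonoidAlgebra k G))

/-- The right action of `kG` on `A ≅ (kG)*` dual to left multiplication, `(a.y)(x) = a(yx)`. -/
def dualAction : MonoidAlgebra k G →ₗ[k] A →ₗ[k] A :=
  LinearMap.mk₂ k (fun y a => e.symm (e a ∘ₗ LinearMap.mulLeft k y))
    (fun y y' a => by rw [← map_add]; congr 1; ext; simp [add_mul])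
    (fun c y a => by rw [← map_smul]; congr 1; ext; simp)
    (fun y a b => by rw [← map_add]; congr 1; ext; simp)
    (fun c y a => by rw [← map_smul]; congr 1; ext; simp)

@[simp] lemma apply_dualAction (y x : MonoidAlgebra k G) (a : A) :
    e (dualAction e y a) x = e a (y * x) := by
  simp [dualAction]

lemma dualAction_mul (p q : MonoidAlgebra k G) (a : A) :
    dualAction e (p * q) a = dualAction e q (dualAction e p a) :=
  e.injective <| LinearMap.ext fun x => by simp only [apply_dualAction, mul_assoc]

lemma dualAction_one (a : A) : dualAction e 1 a = a :=
  e.injective <| LinearMap.ext fun x => by rw [apply_dualAction, one_mul]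

lemma dualDistrib_dualAction (p q : MonoidAlgebra k G) (a b : A) :
    TensorProduct.dualDistrib k _ _ (e (dualAction e p a) ⊗ₜ[k] e (dualAction e q b)) =
      TensorProduct.dualDistrib k _ _ (e a ⊗ₜ[k] e b) ∘ₗ LinearMap.mulLeft k (p ⊗ₜ[k] q) :=
  TensorProduct.ext' fun v w => by simp

variable {e}

lemma dualAction_apply_one (he1 : e 1 = Coalgebra.counit) (y : MonoidAlgebra k G) :
    dualAction e y 1 = Coalgebra.counit (R := k) y • (1 : A) :=
  e.injective <| LinearMap.ext fun x => by
    simp only [apply_dualAction, map_smul, he1, Bialgebra.counit_mul, LinearMap.smul_apply,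
      smul_eq_mul]

variable {J : HopfTwist k (MonoidAlgebra k G)}

lemma dualAction_apply_mul (hemul : ∀ a b : A, e (a * b) = crossedMul J (e a) (e b))
    (y : MonoidAlgebra k G) (a b : A) :
    dualAction e y (a * b) =
      LinearMap.mul' k A (tensorAction (dualAction e) (J.twistedComul y) (a ⊗ₜ b)) := by
  refine e.injective <| LinearMap.ext fun x => ?_
  have hcrossed (w : MonoidAlgebra k G ⊗[k] MonoidAlgebra k G) :
      e (LinearMap.mul' k A (tensorAction (dualAction e) w (a ⊗ₜ b))) x =
        TensorProduct.dualDistrib k _ _ (e a ⊗ₜ[k] e b)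
          (w * ((J.val : MonoidAlgebra k G ⊗[k] MonoidAlgebra k G) * Coalgebra.comul x)) := by
    induction w with
    | zero => simp
    | add v w hv hw => simp only [map_add, LinearMap.add_apply, hv, hw, add_mul]
    | tmul p q =>
      simp only [tensorAction_tmul, TensorProduct.map_tmul, LinearMap.mul'_apply, hemul,
        crossedMul, LinearMap.comp_apply, dualDistrib_dualAction, LinearMap.mulLeft_apply]
  rw [hcrossed, apply_dualAction, hemul, HopfTwist.twistedComul_apply, crossedMul]
  simp [mul_assoc]

variable [MulSemiringAction G A]

lemma dualAction_smul
    (heG : ∀ (g : G) (a : A) x, e (g • a) x = e a (x * MonoidAlgebra.single g 1))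
    (y : MonoidAlgebra k G) (g : G) (a : A) :
    dualAction e y (g • a) = g • dualAction e y a :=
  e.injective <| LinearMap.ext fun x => by simp only [apply_dualAction, heG, mul_assoc]

lemma isEquivariantModuleAlgebra_dualAction (he1 : e 1 = Coalgebra.counit)
    (hemul : ∀ a b : A, e (a * b) = crossedMul J (e a) (e b))
    (heG : ∀ (g : G) (a : A) x, e (g • a) x = e a (x * MonoidAlgebra.single g 1)) :
    IsEquivariantModuleAlgebra (K := J.Twisted) G
      (show J.Twisted →ₗ[k] A →ₗ[k] A from dualAction e) where
  mul_apply := dualAction_mul e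
  one_apply := dualAction_one e
  apply_one := dualAction_apply_one he1
  apply_mul := dualAction_apply_mul hemul
  apply_smul := dualAction_smul heG

variable [SMulCommClass G k A] {F : Subgroup G} [F.Normal]

lemma mem_fixedSubspace_iff_mem_quotientDual (J : HopfTwist k (MonoidAlgebra k G))
    (heG : ∀ (g : G) (a : A) x, e (g • a) x = e a (x * MonoidAlgebra.single g 1)) {a : A} :
    a ∈ fixedSubspace k A F ↔ (show Dual k J.Twisted from e a) ∈ J.quotientDual F := by
  rw [HopfTwist.mem_quotientDual_iff]
  refine forall₂_congr fun n _ => ?_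
  rw [← e.injective.eq_iff, LinearMap.ext_iff]
  simp only [heG]

lemma dualAction_mul_single_of_mem_fixedSubspace
    (heG : ∀ (g : G) (a : A) x, e (g • a) x = e a (x * MonoidAlgebra.single g 1))
    {a : A} (ha : a ∈ fixedSubspace k A F) {n : G} (hn : n ∈ F) (q : MonoidAlgebra k G) :
    dualAction e (q * MonoidAlgebra.single n 1) a = dualAction e q a := by
  refine e.injective <| MonoidAlgebra.lhom_ext' fun u => LinearMap.ext_ring ?_
  have hconj : u⁻¹ * n * u ∈ F := by simpa using (inferInstance : F.Normal).conj_mem n hn u⁻¹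
  have hsingle : MonoidAlgebra.single n (1 : k) * MonoidAlgebra.single u 1 =
      MonoidAlgebra.single u 1 * MonoidAlgebra.single (u⁻¹ * n * u) 1 := by
    simp [MonoidAlgebra.single_mul_single, mul_assoc]
  rw [LinearMap.comp_apply, LinearMap.comp_apply, MonoidAlgebra.lsingle_apply, apply_dualAction,
    apply_dualAction, mul_assoc, hsingle, ← mul_assoc, ← heG, ha _ hconj]

variable [Fintype G] [DecidableEq G]

lemma HopfTwist.CorrespondsTo.isMiyashitaUlbrichStable (hJ : J.CorrespondsTo A)
    (hA : IsGaloisObject k G A) (hF : IsConormal (twistedQuotient J F)) :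
    IsMiyashitaUlbrichStable G (fixedSubspace k A F) := by
  obtain ⟨e, he1, hemul, heG⟩ := hJ
  intro a ha h
  obtain ⟨T, hT⟩ := hA.can_bijective.2 (1 ⊗ₜ h)
  rw [galoisCan_eq_one_tmul_iff] at hT
  rw [miyashitaUlbrich_eq_sandwich hA.can_bijective.1 a hT,
    mem_fixedSubspace_iff_mem_quotientDual J heG]
  have hcoeff (b : A) : e b = (LinearMap.applyₗ (1 : MonoidAlgebra k G) ∘ₗ e.toLinearMap) ∘ₗ
      (dualAction e).flip b :=
    LinearMap.ext fun y => by simp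
  rw [hcoeff]
  exact (isEquivariantModuleAlgebra_dualAction he1 hemul heG).comp_flip_sandwich_mem
    hA.can_bijective.1 hT hF.2 (fun ℓ => HopfTwist.mem_quotientDual_iff.2 fun n hn q =>
      congrArg ℓ (dualAction_mul_single_of_mem_fixedSubspace heG ha hn q)) _

end CrossedProduct

end GroupAlgebraTwist

end

theorem theorem6p2_general {k G : Type*} [Field k] [Group G] [Fintype G] [DecidableEq G]
    (hZ : Subgroup.center G = ⊥)
    (F : Subgroup G) [F.Normal] (hF : F.index.Prime)
    (S : Subgroup G) (α : TwoCocycle S k) (hα : α.IsNondegenerate) :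
    IsGaloisObject k G (galoisObject α) ∧
    (IsMiyashitaUlbrichStable G (fixedSubspace k (galoisObject α) F) ↔ S ≤ F) ∧
    ∀ J : HopfTwist k (MonoidAlgebra k G),
      (J.val : MonoidAlgebra k G ⊗[k] MonoidAlgebra k G) ∈ subgroupTensor k S →
      J.CorrespondsTo (galoisObject α) →
        (IsConormal (twistedQuotient J F) ↔
          (J.val : MonoidAlgebra k G ⊗[k] MonoidAlgebra k G) ∈ subgroupTensor k F) ∧
        (IsConormal (twistedQuotient J F) ↔
          IsMiyashitaUlbrichStable G (fixedSubspace k (galoisObject α) F)) := by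
  have hA : IsGaloisObject k G (galoisObject α) := galoisObject.isGaloisObject hα
  have hstable : IsMiyashitaUlbrichStable G (fixedSubspace k (galoisObject α) F) ↔ S ≤ F :=
    ⟨galoisObject.le_of_isMiyashitaUlbrichStable hα hZ hF,
      galoisObject.isMiyashitaUlbrichStable_of_le hα⟩
  refine ⟨hA, hstable, fun J hJS hJ => ?_⟩
  have hle : IsConormal (twistedQuotient J F) → S ≤ F := fun h =>
    hstable.1 (hJ.isMiyashitaUlbrichStable hA h)
  have hmem : S ≤ F →
      (J.val : MonoidAlgebra k G ⊗[k] MonoidAlgebra k G) ∈ subgroupTensor k F := fun h =>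
    subgroupTensor_mono h hJS
  exact ⟨⟨hmem ∘ hle, HopfTwist.isConormal_of_mem_subgroupTensor⟩,
    hstable.2 ∘ hle, fun h => HopfTwist.isConormal_of_mem_subgroupTensor (hmem (hstable.1 h))⟩

theorem theorem6p2 {k G : Type*} [Field k] [IsAlgClosed k] [CharZero k]
    [Group G] [Fintype G] [DecidableEq G]
    (hZ : Subgroup.center G = ⊥)
    (F : Subgroup G) [F.Normal] (hF : F.index.Prime)
    (S : Subgroup G) (α : TwoCocycle S k) (hα : α.IsNondegenerate) :
    IsGaloisObject k G (galoisObject α) ∧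
    (IsMiyashitaUlbrichStable G (fixedSubspace k (galoisObject α) F) ↔ S ≤ F) ∧
    ∀ J : HopfTwist k (MonoidAlgebra k G),
      (J.val : MonoidAlgebra k G ⊗[k] MonoidAlgebra k G) ∈ subgroupTensor k S →
      J.CorrespondsTo (galoisObject α) →
        (IsConormal (twistedQuotient J F) ↔
          (J.val : MonoidAlgebra k G ⊗[k] MonoidAlgebra k G) ∈ subgroupTensor k F) ∧
        (IsConormal (twistedQuotient J F) ↔
          IsMiyashitaUlbrichStable G (fixedSubspace k (galoisObject α) F)) := by
  exact theorem6p2_general hZ F hF S α hα
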